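/- Let $c\in(0,\infty)$, $r\in(0,1)$ and $s>0$. For $t\ge 0$ let $H_t=(1-r)\,\delta_t+r\,\delta_{s+t}$, and let $F_t$ be the generalized Marchenko--Pastur law with ratio $c$ (the limit of $p/n$) and population distribution $H_t$, that is, the probability measure on $\mathbb R$ whose Cauchy transform $G_t(z)=\int_{\mathbb R}\frac{1}{z-x}\,dF_t(x)$ satisfies, for every $z\in\mathbb C$ with $\Im z>0$, $$G_t(z)=\int_{\mathbb R}\frac{dH_t(x)}{z-x\,(1-c+c\,z\,G_t(z))},\qquad \Im\!\left(\frac{1-c}{z}+c\,G_t(z)\right)<0 .$$ For a closed set $S\subset\mathbb R$ let $N(S)$ be the number of its connected components, and let $U(S)=0$ if $N(S)=1$ and $U(S)=\min_{a\in A,\,b\in B}|a-b|$ if $S$ has exactly two components $A,B$. Write $N(t)=N(\operatorname{Supp}F_t)$ and $U(t)=U(\operatorname{Supp}F_t)$. Then there is a threshold $T=T(c,r,s)\ge 0$ such that for all $t\ge T$: (i) if $c\le 1$, the support of $F_t$ is connected, that is, $N(t)=1$, and hence $U(t)=0$; (ii) if $c>1$, then $F_t(\{0\})=1-\frac1c$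 (the null eigenvalues forced by $p>n$), and apart from this atom the support is connected: the support $S_t$ of the restriction of $F_t$ to $\mathbb R\setminus\{0\}$ satisfies $N(S_t)=1$ and $U(S_t)=0$. So for large noise power there is no gap between the "information" and the "noise" eigenvalues. -/

import Mathlib

open MeasureTheory

namespace NoisyPCA

noncomputable section

/-- The Cauchy transform `G(z) = ∫ 1 / (z - x) dF(x)` of a measure on the real line. -/
def cauchyTransform (F : Measure ℝ) (z : ℂ) : ℂ :=
  ∫ x, 1 / (z - (x : ℂ)) ∂F

/-- `F` is a generalized Marchenko-Pastur law with ratio `c` and population distribution `H`: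
a probability measure such that, for every `z` in the upper half-plane, its Cauchy transform
`G(z)` lies in `D_{c,z} = {G | (1 - c) / z + c G ∈ ℂ⁻}` and solves
`G = ∫ 1 / (z - x (1 - c + c z G)) dH(x)`. -/
structure IsMPLaw (c : ℝ) (H F : Measure ℝ) : Prop where
  isProbabilityMeasure : IsProbabilityMeasure F
  mem_domain : ∀ z : ℂ, 0 < z.im →
    ((1 - (c : ℂ)) / z + (c : ℂ) * cauchyTransform F z).im < 0
  equation : ∀ z : ℂ, 0 < z.im →
    cauchyTransform F z =
      ∫ x, 1 / (z - (x : ℂ) * (1 - (c : ℂ) + (c : ℂ) * z * cauchyTransform F z)) ∂H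

open Classical in
/-- The limiting distribution `F^{c,H}` determined by the Marchenko-Pastur equation.
(It is the zero measure if there is no such law, so that nothing about existence is assumed.) -/
def mpLaw (c : ℝ) (H : Measure ℝ) : Measure ℝ :=
  if h : ∃ F : Measure ℝ, IsMPLaw c H F then h.choose else 0

/-- The population eigenvalue distribution `H_t = (1 - r) δ_t + r δ_{s + t}`. -/
def populationLaw (r s t : ℝ) : Measure ℝ :=
  ENNReal.ofReal (1 - r) • Measure.dirac t + ENNReal.ofReal r • Measure.dirac (s + t)

/-- The limiting eigenvalue distribution `F_t = F^{c,H_t}`. -/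
def limitLaw (c r s t : ℝ) : Measure ℝ :=
  mpLaw c (populationLaw r s t)

/-- The number of connected components of a set of reals. -/
def componentCount (S : Set ℝ) : ℕ∞ :=
  ENat.card (ConnectedComponents S)

open Classical in
/-- The gap of a set of reals: zero if it has one connected component, and the smallest distance
between points of different components if it has two. -/
def componentGap (S : Set ℝ) : ℝ :=
  if componentCount S = 1 then 0
  else sInf {d : ℝ | ∃ a ∈ S, ∃ b ∈ S,
    connectedComponentIn S a ≠ connectedComponentIn S b ∧ d = |a - b|}

/-- `N(t)`, the number of connected components of the support of `F_t`. -/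
def numComponents (c r s t : ℝ) : ℕ∞ :=
  componentCount (limitLaw c r s t).support

/-- The utility function `U(t)`. -/
def utility (c r s t : ℝ) : ℝ :=
  componentGap (limitLaw c r s t).support

/-- The support of the part of `F_t` that is carried by the nonzero eigenvalues. -/
def nonzeroSupport (c r s t : ℝ) : Set ℝ :=
  ((limitLaw c r s t).restrict {0}ᶜ).support

end

end NoisyPCA

/-! Put `w = 1 / ((1 - c) / z + c G(z))`. The Marchenko–Pastur equation becomes `P(w) = z`, where
`P(w) = w + c ∫ x w / (w - x) dH_t(x)` is a rational map with poles `t` and `s + t` (`isMPLaw_iff`).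
Since `Im P(w) = Im w (1 - slope w)`, the solution `w` lies where `slope < 1`; on the real line
`slope = 1 - P'`.

As in the Silverstein–Choi analysis, away from `0` the complement of the support is read off from
the real points where `P` increases: if `slope v < 1` and `P(v) ≠ 0`, then `P(v)` is outside the
support (`exists_measure_Icc_eq_zero`), and every nonzero point outside it is `P(v)` with `slope v ≤
1` (`exists_realMap_eq_of_notMem_support`). A gap can thus only come from an increasing piece
between the two poles. There `slope > k₁ / s²` with `k₁ = c (1 - r) t²`, so for large `t` no such
piece exists. Only the two outer branches remain, and they leave a single interval, together with a
possible atom at `0` (`exists_support_eq`).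

The atom is the limit of `z G(z)`, that is, of `P(w) / w` near a real zero of `P` (`tendsto_atom`).
Existence of the law is proved for parameter `1` by iterating `w ↦ z - (P(w) - w)` and passing to a
weak limit; other values of `c` follow by adding or removing an atom at `0`. Uniqueness is not
needed, since the argument applies to any law. -/

namespace NoisyPCA

open Filter Topology Set

/-! ### Cauchy transforms: analyticity, local mass bounds, the atom at `0` -/

lemma sub_ofReal_ne_zero {z : ℂ} (hz : 0 < z.im) (x : ℝ) : z - (x : ℂ) ≠ 0 := by
  intro h
  have := congrArg Complex.im h
  simp at this
  exact hz.ne' this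

lemma im_le_norm_sub_ofReal (z : ℂ) (x : ℝ) : z.im ≤ ‖z - (x : ℂ)‖ := by
  have h := Complex.abs_im_le_norm (z - (x : ℂ))
  simp only [Complex.sub_im, Complex.ofReal_im, sub_zero] at h
  exact (le_abs_self _).trans h

lemma norm_one_div_sub_ofReal_le {z : ℂ} (hz : 0 < z.im) (x : ℝ) :
    ‖1 / (z - (x : ℂ))‖ ≤ 1 / z.im := by
  rw [norm_div, norm_one]
  exact one_div_le_one_div_of_le hz (im_le_norm_sub_ofReal z x)

lemma continuous_one_div_sub_ofReal {z : ℂ} (hz : 0 < z.im) :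
    Continuous fun x : ℝ => 1 / (z - (x : ℂ)) :=
  continuous_const.div (by fun_prop) (sub_ofReal_ne_zero hz)

lemma integrable_one_div_sub_ofReal (F : Measure ℝ) [IsFiniteMeasure F] {z : ℂ} (hz : 0 < z.im) :
    Integrable (fun x : ℝ => 1 / (z - (x : ℂ))) F :=
  Integrable.of_bound (continuous_one_div_sub_ofReal hz).aestronglyMeasurable (1 / z.im)
    (Eventually.of_forall fun x => norm_one_div_sub_ofReal_le hz x)

lemma im_one_div_sub_ofReal (z : ℂ) (x : ℝ) :
    (1 / (z - (x : ℂ))).im = -(z.im / Complex.normSq (z - (x : ℂ))) := by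
  rw [one_div, Complex.inv_im]
  simp [neg_div]

lemma cauchyTransform_eq_neg_resolventTransform (F : Measure ℝ) (z : ℂ) :
    cauchyTransform F z = -resolventTransform F z := by
  rw [cauchyTransform, resolventTransform_apply, ← integral_neg]
  congr 1
  ext x
  rw [resolvent, Ring.inverse_eq_inv', one_div, ← inv_neg, neg_sub]
  rfl

lemma neg_im_cauchyTransform (F : Measure ℝ) [IsFiniteMeasure F] {z : ℂ} (hz : 0 < z.im) :
    -(cauchyTransform F z).im = ∫ x, z.im / Complex.normSq (z - (x : ℂ)) ∂F := by
  have h := integral_im (𝕜 := ℂ) (integrable_one_div_sub_ofReal F hz)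
  simp only [RCLike.im_eq_complex_im, im_one_div_sub_ofReal, integral_neg] at h
  rw [cauchyTransform, ← h, neg_neg]

lemma integrable_poisson (F : Measure ℝ) [IsFiniteMeasure F] {z : ℂ} (hz : 0 < z.im) :
    Integrable (fun x : ℝ => z.im / Complex.normSq (z - (x : ℂ))) F := by
  have h := (integrable_one_div_sub_ofReal F hz).im.neg
  refine h.congr (Eventually.of_forall fun x => ?_)
  simp only [Pi.neg_apply, RCLike.im_eq_complex_im, im_one_div_sub_ofReal, neg_neg]

lemma im_cauchyTransform_neg (F : Measure ℝ) [IsProbabilityMeasure F] {z : ℂ} (hz : 0 < z.im) :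
    (cauchyTransform F z).im < 0 := by
  rw [← neg_pos, neg_im_cauchyTransform F hz]
  have hpos : ∀ x : ℝ, 0 < z.im / Complex.normSq (z - (x : ℂ)) := fun x =>
    div_pos hz (Complex.normSq_pos.2 (sub_ofReal_ne_zero hz x))
  rw [integral_pos_iff_support_of_nonneg (fun x => (hpos x).le) (integrable_poisson F hz)]
  have : Function.support (fun x : ℝ => z.im / Complex.normSq (z - (x : ℂ))) = univ := by
    ext x; simpa using (hpos x).ne'
  rw [this]; simp

lemma differentiableAt_cauchyTransform (F : Measure ℝ) [IsFiniteMeasure F] {z : ℂ}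
    (hz : ∀ x ∈ F.support, (x : ℂ) ≠ z) : DifferentiableAt ℂ (cauchyTransform F) z := by
  have h : cauchyTransform F = fun z => -resolventTransform F z :=
    funext fun z => cauchyTransform_eq_neg_resolventTransform F z
  rw [h]
  refine (hasDerivAt_resolventTransform z ?_).differentiableAt.neg
  rintro ⟨x, hx, rfl⟩
  exact hz x hx rfl

lemma differentiableAt_cauchyTransform_of_im_pos (F : Measure ℝ) [IsFiniteMeasure F] {z : ℂ}
    (hz : 0 < z.im) : DifferentiableAt ℂ (cauchyTransform F) z :=
  differentiableAt_cauchyTransform F fun x _ h => by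
    rw [← h] at hz; simp at hz

lemma cauchyTransform_ofReal (F : Measure ℝ) (x : ℝ) :
    cauchyTransform F x = ((∫ y, 1 / (x - y) ∂F : ℝ) : ℂ) := by
  rw [cauchyTransform, ← integral_complex_ofReal]
  push_cast
  rfl

/-- The Poisson kernel `ε / ((x - y)² + ε²)` is at least `1 / (2ε)` for `|x - y| ≤ ε`. -/
lemma real_Icc_le_neg_im_cauchyTransform (F : Measure ℝ) [IsFiniteMeasure F] (x : ℝ) {ε : ℝ}
    (hε : 0 < ε) :
    F.real (Icc (x - ε) (x + ε)) ≤ 2 * ε * -(cauchyTransform F (x + ε * Complex.I)).im := by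
  have hz : 0 < ((x : ℂ) + ε * Complex.I).im := by simpa using hε
  rw [neg_im_cauchyTransform F hz, ← integral_const_mul, ← integral_indicator_one measurableSet_Icc]
  refine integral_mono ((integrable_const 1).indicator measurableSet_Icc)
    ((integrable_poisson F hz).const_mul _) fun y => ?_
  have him : ((x : ℂ) + ε * Complex.I).im = ε := by simp
  have hn : Complex.normSq ((x : ℂ) + ε * Complex.I - (y : ℂ)) = (x - y) ^ 2 + ε ^ 2 := by
    rw [Complex.normSq_apply]; simp; ring
  simp only [him, hn]
  by_cases hy : y ∈ Icc (x - ε) (x + ε)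
  · rw [indicator_of_mem hy, Pi.one_apply, ← mul_div_assoc, le_div_iff₀ (by positivity)]
    obtain ⟨h1, h2⟩ := hy
    nlinarith [mul_nonneg (sub_nonneg.2 h1) (sub_nonneg.2 h2)]
  · rw [indicator_of_notMem hy]
    positivity

/-- Cover the interval by `n + 1` intervals of half-length `ε = δ / (n + 1)`. Each has mass at most
`2 M ε²`, so the total is `O(1 / n)`. -/
lemma measure_Icc_eq_zero_of_im_cauchyTransform_le (F : Measure ℝ) [IsFiniteMeasure F]
    {x₀ δ M : ℝ} (hδ : 0 < δ)
    (h : ∀ x ∈ Icc (x₀ - δ) (x₀ + δ), ∀ ε : ℝ, 0 < ε → ε ≤ δ →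
      -(cauchyTransform F (x + ε * Complex.I)).im ≤ M * ε) :
    F (Icc (x₀ - δ) (x₀ + δ)) = 0 := by
  have key : ∀ n : ℕ, F.real (Icc (x₀ - δ) (x₀ + δ)) ≤ 2 * M * δ ^ 2 / ((n : ℝ) + 1) := by
    intro n
    set ε := δ / ((n : ℝ) + 1) with hεd
    have hn : (0 : ℝ) < (n : ℝ) + 1 := by positivity
    have hε : 0 < ε := by positivity
    have hεn : ε * ((n : ℝ) + 1) = δ := by rw [hεd]; field_simp
    have hεδ : ε ≤ δ := div_le_self hδ.le (by linarith [Nat.cast_nonneg (α := ℝ) n])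
    let y : ℕ → ℝ := fun j => x₀ - δ + (2 * j + 1) * ε
    have hcover : Icc (x₀ - δ) (x₀ + δ) ⊆ ⋃ j ∈ Finset.range (n + 1),
        Icc (y j - ε) (y j + ε) := by
      intro u hu
      simp only [mem_iUnion, Finset.mem_range]
      obtain ⟨h1, h2⟩ := hu
      have hnn : 0 ≤ (u - (x₀ - δ)) / (2 * ε) := div_nonneg (by linarith) (by positivity)
      rcases lt_or_ge (Nat.floor ((u - (x₀ - δ)) / (2 * ε))) (n + 1) with hj | hj
      · refine ⟨_, hj, ?_⟩
        have f1 := Nat.floor_le hnn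
        have f2 := Nat.lt_floor_add_one ((u - (x₀ - δ)) / (2 * ε))
        rw [le_div_iff₀ (by positivity)] at f1
        rw [div_lt_iff₀ (by positivity)] at f2
        constructor <;> simp only [y] <;> nlinarith
      · refine ⟨n, by omega, ?_⟩
        have f1 := Nat.floor_le hnn
        rw [le_div_iff₀ (by positivity)] at f1
        have hj' : (n : ℝ) + 1 ≤ (Nat.floor ((u - (x₀ - δ)) / (2 * ε)) : ℝ) := by exact_mod_cast hj
        have : ((n : ℝ) + 1) * (2 * ε) ≤ u - (x₀ - δ) :=
          (mul_le_mul_of_nonneg_right hj' (by positivity)).trans f1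
        constructor <;> simp only [y] <;> nlinarith
    calc F.real (Icc (x₀ - δ) (x₀ + δ))
        ≤ F.real (⋃ j ∈ Finset.range (n + 1), Icc (y j - ε) (y j + ε)) :=
          measureReal_mono hcover (measure_ne_top _ _)
      _ ≤ ∑ j ∈ Finset.range (n + 1), F.real (Icc (y j - ε) (y j + ε)) :=
          measureReal_biUnion_finset_le _ _
      _ ≤ ∑ j ∈ Finset.range (n + 1), 2 * ε * (M * ε) := by
          refine Finset.sum_le_sum fun j hj => ?_
          refine (real_Icc_le_neg_im_cauchyTransform F (y j) hε).trans ?_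
          refine mul_le_mul_of_nonneg_left (h _ ?_ ε hε hεδ) (by positivity)
          have hj' : (j : ℝ) + 1 ≤ (n : ℝ) + 1 := by
            exact_mod_cast Finset.mem_range.1 hj
          have hj0 : (0 : ℝ) ≤ j := Nat.cast_nonneg j
          constructor <;> simp only [y] <;> nlinarith
      _ = 2 * M * δ ^ 2 / ((n : ℝ) + 1) := by
          rw [Finset.sum_const, Finset.card_range, nsmul_eq_mul, ← hεn]
          push_cast
          field_simp
  have hlim : Tendsto (fun n : ℕ => 2 * M * δ ^ 2 / ((n : ℝ) + 1)) atTop (𝓝 0) :=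
    tendsto_const_nhds.div_atTop (tendsto_atTop_add_const_right _ _ tendsto_natCast_atTop_atTop)
  have h0 : F.real (Icc (x₀ - δ) (x₀ + δ)) ≤ 0 := ge_of_tendsto' hlim key
  have h1 := le_antisymm h0 measureReal_nonneg
  rwa [measureReal_eq_zero_iff] at h1

/-- Dominated convergence: `iε / (iε - x)` has norm at most `1` and tends to the indicator of `x =
0`. -/
lemma tendsto_mul_cauchyTransform (F : Measure ℝ) [IsFiniteMeasure F] :
    Tendsto (fun ε : ℝ => (ε * Complex.I) * cauchyTransform F (ε * Complex.I)) (𝓝[>] 0)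
      (𝓝 (F.real {0} : ℂ)) := by
  have e : (F.real {0} : ℂ) = ∫ x, ({0} : Set ℝ).indicator (fun _ => (1 : ℂ)) x ∂F := by
    rw [integral_indicator_const _ (measurableSet_singleton 0)]
    simp
  have hpos : ∀ ε : ℝ, 0 < ε → 0 < ((ε : ℂ) * Complex.I).im := fun ε hε => by simpa using hε
  simp_rw [e, cauchyTransform, ← integral_const_mul]
  refine tendsto_integral_filter_of_dominated_convergence (fun _ => (1 : ℝ)) ?_ ?_
    (integrable_const _) ?_
  · filter_upwards [self_mem_nhdsWithin] with ε hε
    exact ((continuous_one_div_sub_ofReal (hpos ε hε)).const_smul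
      ((ε : ℂ) * Complex.I)).aestronglyMeasurable
  · filter_upwards [self_mem_nhdsWithin] with ε hε
    refine Eventually.of_forall fun x => ?_
    have h := norm_one_div_sub_ofReal_le (hpos ε hε) x
    have hε' : 0 < ε := hε
    have him : ((ε : ℂ) * Complex.I).im = ε := by simp
    rw [him] at h
    rw [norm_mul, norm_mul, Complex.norm_I, Complex.norm_real, Real.norm_of_nonneg hε'.le, mul_one]
    calc ε * _ ≤ ε * (1 / ε) := mul_le_mul_of_nonneg_left h hε'.le
      _ = 1 := by field_simp
  · refine Eventually.of_forall fun x => ?_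
    rcases eq_or_ne x 0 with rfl | hx
    · rw [indicator_of_mem (mem_singleton _)]
      refine tendsto_const_nhds.congr' ?_
      filter_upwards [self_mem_nhdsWithin] with ε hε
      have : (ε : ℂ) ≠ 0 := by exact_mod_cast (ne_of_gt hε)
      have hI := Complex.I_ne_zero
      rw [Complex.ofReal_zero, sub_zero, mul_one_div_cancel (mul_ne_zero this hI)]
    · rw [indicator_of_notMem (by simpa using hx)]
      have hc : ContinuousAt (fun ε : ℝ => (ε : ℂ) * Complex.I *
          (1 / ((ε : ℂ) * Complex.I - (x : ℂ)))) 0 := by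
        refine ContinuousAt.mul (by fun_prop) (ContinuousAt.div (by fun_prop) (by fun_prop) ?_)
        simpa using hx
      have h := hc.tendsto.mono_left (nhdsWithin_le_nhds (s := Ioi 0))
      simpa using h

/-! ### Two-pole rational maps on the upper half-plane -/

/-- The parameters of a rational map `w ↦ w + C + k₁ / (w - x₁) + k₂ / (w - x₂)`. -/
structure TwoPoleMap where
  C : ℝ
  k₁ : ℝ
  k₂ : ℝ
  x₁ : ℝ
  x₂ : ℝ
  k₁_pos : 0 < k₁
  k₂_pos : 0 < k₂

namespace TwoPoleMap

variable (P : TwoPoleMap)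

/-- The rational map on the complex plane. -/
noncomputable def map (w : ℂ) : ℂ :=
  w + P.C + P.k₁ / (w - P.x₁) + P.k₂ / (w - P.x₂)

/-- The rational map on the real line. -/
noncomputable def realMap (v : ℝ) : ℝ :=
  v + P.C + P.k₁ / (v - P.x₁) + P.k₂ / (v - P.x₂)

/-- An upper bound for `|1 - map' w|`, equal to `1 - Im (map w) / Im w` off the real line. -/
noncomputable def slope (w : ℂ) : ℝ :=
  P.k₁ / Complex.normSq (w - P.x₁) + P.k₂ / Complex.normSq (w - P.x₂)

/-- The value of `1 - realMap'`. -/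
noncomputable def realSlope (v : ℝ) : ℝ :=
  P.k₁ / (v - P.x₁) ^ 2 + P.k₂ / (v - P.x₂) ^ 2

lemma map_ofReal (v : ℝ) : P.map v = (P.realMap v : ℂ) := by
  simp [map, realMap]

lemma slope_ofReal (v : ℝ) : P.slope v = P.realSlope v := by
  have h : ∀ x : ℝ, Complex.normSq ((v : ℂ) - x) = (v - x) ^ 2 := fun x => by
    rw [← Complex.ofReal_sub, Complex.normSq_ofReal, sq]
  simp only [slope, realSlope, h]

lemma slope_nonneg (w : ℂ) : 0 ≤ P.slope w :=
  add_nonneg (div_nonneg P.k₁_pos.le (Complex.normSq_nonneg _))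
    (div_nonneg P.k₂_pos.le (Complex.normSq_nonneg _))

lemma im_map (w : ℂ) : (P.map w).im = w.im * (1 - P.slope w) := by
  simp only [map, slope, Complex.add_im, Complex.ofReal_im, Complex.div_im, Complex.ofReal_re,
    Complex.sub_im]
  ring

lemma slope_lt_one {w : ℂ} (hw : 0 < w.im) (h : 0 < (P.map w).im) : P.slope w < 1 := by
  rw [im_map] at h
  linarith [(pos_iff_pos_of_mul_pos h).1 hw]

lemma continuousAt_map {w : ℂ} (h₁ : w ≠ P.x₁) (h₂ : w ≠ P.x₂) : ContinuousAt P.map w := by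
  have := sub_ne_zero.2 h₁
  have := sub_ne_zero.2 h₂
  unfold map
  fun_prop (disch := assumption)

lemma continuousAt_slope {w : ℂ} (h₁ : w ≠ P.x₁) (h₂ : w ≠ P.x₂) : ContinuousAt P.slope w := by
  have := Complex.normSq_eq_zero.not.2 (sub_ne_zero.2 h₁)
  have := Complex.normSq_eq_zero.not.2 (sub_ne_zero.2 h₂)
  have := Complex.continuous_normSq
  unfold slope
  fun_prop (disch := assumption)

lemma map_sub_map {w v : ℂ} (hw₁ : w ≠ P.x₁) (hw₂ : w ≠ P.x₂) (hv₁ : v ≠ P.x₁) (hv₂ : v ≠ P.x₂) :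
    P.map w - P.map v = (w - v) * (1 - P.k₁ / ((w - P.x₁) * (v - P.x₁))
      - P.k₂ / ((w - P.x₂) * (v - P.x₂))) := by
  have := sub_ne_zero.2 hw₁
  have := sub_ne_zero.2 hw₂
  have := sub_ne_zero.2 hv₁
  have := sub_ne_zero.2 hv₂
  unfold map
  field_simp
  ring

lemma norm_div_mul_le {k : ℝ} (hk : 0 ≤ k) (a b : ℂ) :
    ‖(k : ℂ) / (a * b)‖ ≤ (k / Complex.normSq a + k / Complex.normSq b) / 2 := by
  rw [norm_div, norm_mul, Complex.norm_real, Real.norm_of_nonneg hk, Complex.normSq_eq_norm_sq,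
    Complex.normSq_eq_norm_sq]
  simp only [div_eq_mul_inv, mul_inv, ← inv_pow]
  nlinarith [mul_nonneg hk (sq_nonneg (‖a‖⁻¹ - ‖b‖⁻¹))]

/-- Quantitative injectivity where the slope is below one: in the factored difference, AM-GM bounds
each `k / (a b)` by the mean of the two slope terms. It takes the place of an inverse function
theorem. -/
lemma norm_map_sub_map_ge {w v : ℂ} (hw₁ : w ≠ P.x₁) (hw₂ : w ≠ P.x₂) (hv₁ : v ≠ P.x₁)
    (hv₂ : v ≠ P.x₂) :
    ‖w - v‖ * (1 - (P.slope w + P.slope v) / 2) ≤ ‖P.map w - P.map v‖ := by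
  rw [P.map_sub_map hw₁ hw₂ hv₁ hv₂, norm_mul]
  refine mul_le_mul_of_nonneg_left ?_ (norm_nonneg _)
  have h1 := norm_div_mul_le P.k₁_pos.le (w - P.x₁) (v - P.x₁)
  have h2 := norm_div_mul_le P.k₂_pos.le (w - P.x₂) (v - P.x₂)
  have h3 := norm_sub_norm_le (1 : ℂ) ((P.k₁ : ℂ) / ((w - P.x₁) * (v - P.x₁))
    + P.k₂ / ((w - P.x₂) * (v - P.x₂)))
  have h4 := norm_add_le ((P.k₁ : ℂ) / ((w - P.x₁) * (v - P.x₁)))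
    (P.k₂ / ((w - P.x₂) * (v - P.x₂)))
  rw [norm_one] at h3
  rw [sub_sub]
  unfold slope
  linarith

lemma ne_ofReal_of_im_pos {w : ℂ} (hw : 0 < w.im) (x : ℝ) : w ≠ x :=
  sub_ne_zero.1 (sub_ofReal_ne_zero hw x)

lemma norm_sub_ofReal_mul_le {w : ℂ} (hw : 0 < w.im) (h : 0 < (P.map w).im) {v : ℝ}
    (hv₁ : v ≠ P.x₁) (hv₂ : v ≠ P.x₂) :
    ‖w - v‖ * ((1 - P.realSlope v) / 2) ≤ ‖P.map w - P.realMap v‖ := by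
  have h1 := P.norm_map_sub_map_ge (ne_ofReal_of_im_pos hw P.x₁) (ne_ofReal_of_im_pos hw P.x₂)
    (v := v) (by exact_mod_cast hv₁) (by exact_mod_cast hv₂)
  rw [map_ofReal, slope_ofReal] at h1
  refine le_trans (mul_le_mul_of_nonneg_left ?_ (norm_nonneg _)) h1
  linarith [P.slope_lt_one hw h]

end TwoPoleMap

/-! ### From the subordination function to the support and the atom -/

/-- `F` is a probability measure for which `(1 - c) / z + c G(z)` is the reciprocal of a preimage
of `z` under `P` in the upper half-plane. -/
def IsSubordinated (c : ℝ) (P : TwoPoleMap) (F : Measure ℝ) : Prop :=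
  IsProbabilityMeasure F ∧ ∀ z : ℂ, 0 < z.im → ∃ w : ℂ, 0 < w.im ∧ P.map w = z ∧
    w⁻¹ = (1 - (c : ℂ)) / z + (c : ℂ) * cauchyTransform F z

namespace IsSubordinated

variable {c : ℝ} {P : TwoPoleMap} {F : Measure ℝ}

/-- For `z` close to `P(v)`, the preimage `w` is forced close to `v`, where the slope stays away
from one. Hence `Im w = O(Im z)`, so `Im G(z) = O(Im z)` and there is no mass nearby. -/
lemma exists_measure_Icc_eq_zero (h : IsSubordinated c P F) (hc : 0 < c) {v : ℝ}
    (hv₁ : v ≠ P.x₁) (hv₂ : v ≠ P.x₂) (hq : P.realSlope v < 1) (hv : v ≠ 0)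
    (hx : P.realMap v ≠ 0) :
    ∃ δ : ℝ, 0 < δ ∧ F (Icc (P.realMap v - δ) (P.realMap v + δ)) = 0 := by
  obtain ⟨hF, hw⟩ := h
  set x₀ := P.realMap v with hx₀
  set q := P.realSlope v with hqd
  have hvC₁ : (v : ℂ) ≠ P.x₁ := by exact_mod_cast hv₁
  have hvC₂ : (v : ℂ) ≠ P.x₂ := by exact_mod_cast hv₂
  have hnear : ∀ᶠ w in 𝓝 (v : ℂ), P.slope w < (1 + q) / 2 ∧ |v| / 2 < ‖w‖ := by
    refine ((P.continuousAt_slope hvC₁ hvC₂).eventually_lt continuousAt_const ?_).and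
      (continuousAt_const.eventually_lt continuous_norm.continuousAt ?_)
    · rw [P.slope_ofReal]; linarith
    · rw [Complex.norm_real, Real.norm_eq_abs]; linarith [abs_pos.2 hv]
  obtain ⟨η, hη, hball⟩ := Metric.eventually_nhds_iff.1 hnear
  have hq' : 0 < 1 - q := by linarith
  have hx₀' := abs_pos.2 hx
  have hv' := abs_pos.2 hv
  -- The first bound keeps `z` away from `0`; the second gives `‖w - v‖ (1 - q) / 2 ≤ 2δ ≤ η (1 - q)
  -- / 4`, so `w` stays in the ball of radius `η`.
  set δ := min (|x₀| / 2) (η * (1 - q) / 8) with hδd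
  have hδ : 0 < δ := lt_min (by positivity) (by positivity)
  have hδ₁ : δ ≤ |x₀| / 2 := min_le_left _ _
  have hδ₂ : δ ≤ η * (1 - q) / 8 := min_le_right _ _
  refine ⟨δ, hδ, measure_Icc_eq_zero_of_im_cauchyTransform_le F
    (M := (2 / (1 - q) / (|v| / 2) ^ 2 + |1 - c| / (|x₀| / 2) ^ 2) / c) hδ ?_⟩
  intro x hxI ε hε hεδ
  set z : ℂ := x + ε * Complex.I with hz
  have hzim : z.im = ε := by simp [hz]
  have hzre : z.re = x := by simp [hz]
  obtain ⟨w, hwim, hwz, hwG⟩ := hw z (by rw [hzim]; exact hε)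
  have hxx : |x - x₀| ≤ δ := abs_le.2 ⟨by linarith [hxI.1], by linarith [hxI.2]⟩
  have hd : ‖z - x₀‖ ≤ 2 * δ := by
    have : z - x₀ = ((x - x₀ : ℝ) : ℂ) + (ε : ℂ) * Complex.I := by rw [hz]; push_cast; ring
    rw [this]
    refine (norm_add_le _ _).trans ?_
    rw [norm_mul, Complex.norm_I, Complex.norm_real, Complex.norm_real, Real.norm_eq_abs,
      Real.norm_of_nonneg hε.le]
    linarith
  have hb := P.norm_sub_ofReal_mul_le hwim (by rw [hwz, hzim]; exact hε) hv₁ hv₂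
  rw [hwz, ← hx₀, ← hqd] at hb
  have hwv : ‖w - v‖ < η := by
    by_contra! hcon
    have := mul_le_mul_of_nonneg_right hcon (by linarith : 0 ≤ (1 - q) / 2)
    nlinarith [mul_pos hη hq']
  obtain ⟨hs, hn⟩ := hball (by rwa [dist_eq_norm])
  have him := P.im_map w
  rw [hwz, hzim] at him
  have hwim' : w.im ≤ 2 / (1 - q) * ε := by
    rw [div_mul_eq_mul_div, le_div_iff₀ hq']
    nlinarith [mul_pos hwim hq']
  have e1 : -(w⁻¹).im ≤ 2 / (1 - q) / (|v| / 2) ^ 2 * ε := by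
    rw [Complex.inv_im, neg_div, neg_neg, Complex.normSq_eq_norm_sq, div_mul_eq_mul_div]
    gcongr
  have e2 : ((1 - (c : ℂ)) / z).im ≤ |1 - c| / (|x₀| / 2) ^ 2 * ε := by
    have h1 : (1 - (c : ℂ)) / z = ((1 - c : ℝ) : ℂ) * z⁻¹ := by push_cast; rw [div_eq_mul_inv]
    have h2 : (|x₀| / 2) ^ 2 ≤ Complex.normSq z := by
      have h3 : |x₀| / 2 ≤ |x| := by
        have := abs_sub_abs_le_abs_sub x₀ x
        rw [abs_sub_comm] at this
        linarith
      rw [Complex.normSq_apply, hzre, hzim]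
      nlinarith [sq_abs x, mul_self_le_mul_self (by positivity) h3, sq_nonneg ε]
    have h0 : 0 < Complex.normSq z := lt_of_lt_of_le (by positivity) h2
    rw [h1, Complex.im_ofReal_mul, Complex.inv_im, hzim, mul_div_assoc', div_mul_eq_mul_div]
    calc (1 - c) * -ε / Complex.normSq z ≤ |1 - c| * ε / Complex.normSq z := by
          refine div_le_div_of_nonneg_right ?_ h0.le
          nlinarith [neg_abs_le (1 - c)]
      _ ≤ _ := by gcongr
  have e3 : c * -(cauchyTransform F z).im = -(w⁻¹).im + ((1 - (c : ℂ)) / z).im := by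
    rw [hwG, Complex.add_im, Complex.im_ofReal_mul]; ring
  rw [div_mul_eq_mul_div, le_div_iff₀ hc]
  linarith

/-- Along `z = iε` the preimage `w` tends to `v`, while `P(w) / w = z / w = 1 - c + c z G(z)` tends
to `1 - c + c F({0})`. -/
lemma tendsto_atom (h : IsSubordinated c P F) {v : ℝ} (hv₁ : v ≠ P.x₁) (hv₂ : v ≠ P.x₂)
    (hq : P.realSlope v < 1) (hx : P.realMap v = 0) {ℓ : ℂ}
    (hℓ : Tendsto (fun w => P.map w / w) (𝓝[≠] (v : ℂ)) (𝓝 ℓ)) :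
    (c : ℂ) * F.real {0} = ℓ - (1 - c) := by
  obtain ⟨hF, hw⟩ := h
  choose! w hwim hwz hwG using hw
  have hpos : ∀ ε : ℝ, 0 < ε → 0 < ((ε : ℂ) * Complex.I).im := fun ε hε => by simpa using hε
  have hq' : 0 < (1 - P.realSlope v) / 2 := by linarith
  have hlim : Tendsto (fun ε : ℝ => w (ε * Complex.I)) (𝓝[>] 0) (𝓝[≠] (v : ℂ)) := by
    refine tendsto_nhdsWithin_iff.2 ⟨?_, ?_⟩
    · rw [tendsto_iff_norm_sub_tendsto_zero]
      have h0 : Tendsto (fun ε : ℝ => ε / ((1 - P.realSlope v) / 2)) (𝓝[>] 0) (𝓝 0) := by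
        have : ContinuousAt (fun ε : ℝ => ε / ((1 - P.realSlope v) / 2)) 0 := by fun_prop
        simpa using this.tendsto.mono_left (nhdsWithin_le_nhds (s := Ioi 0))
      refine tendsto_of_tendsto_of_tendsto_of_le_of_le' tendsto_const_nhds h0
        (Eventually.of_forall fun _ => norm_nonneg _) ?_
      filter_upwards [self_mem_nhdsWithin] with ε hε
      have hε' : 0 < ε := hε
      have hb := P.norm_sub_ofReal_mul_le (hwim _ (hpos ε hε))
        (by rw [hwz _ (hpos ε hε)]; exact hpos ε hε) hv₁ hv₂
      rw [hwz _ (hpos ε hε), hx, Complex.ofReal_zero, sub_zero, norm_mul, Complex.norm_I,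
        Complex.norm_real, Real.norm_of_nonneg hε'.le, mul_one] at hb
      rwa [le_div_iff₀ hq']
    · filter_upwards [self_mem_nhdsWithin] with ε hε
      exact TwoPoleMap.ne_ofReal_of_im_pos (hwim _ (hpos ε hε)) v
  have h1 := hℓ.comp hlim
  have h2 := ((tendsto_mul_cauchyTransform F).const_mul (c : ℂ)).add_const (1 - (c : ℂ))
  have h3 : (fun ε : ℝ => (c : ℂ) * ((ε * Complex.I) * cauchyTransform F (ε * Complex.I))
      + (1 - (c : ℂ))) =ᶠ[𝓝[>] 0]
      ((fun w => P.map w / w) ∘ fun ε : ℝ => w (ε * Complex.I)) := by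
    filter_upwards [self_mem_nhdsWithin] with ε hε
    have hz0 : (ε : ℂ) * Complex.I ≠ 0 :=
      mul_ne_zero (by exact_mod_cast (ne_of_gt hε)) Complex.I_ne_zero
    rw [Function.comp_apply, hwz _ (hpos ε hε), div_eq_mul_inv _ (w _), hwG _ (hpos ε hε), mul_add,
      mul_div_cancel₀ _ hz0]
    ring
  have h4 := tendsto_nhds_unique (h2.congr' h3) h1
  rw [← h4]
  ring

lemma atom_of_ne_zero (h : IsSubordinated c P F) {v : ℝ} (hv₁ : v ≠ P.x₁) (hv₂ : v ≠ P.x₂)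
    (hq : P.realSlope v < 1) (hx : P.realMap v = 0) (hv : v ≠ 0) : c * F.real {0} = c - 1 := by
  have hvC₁ : (v : ℂ) ≠ P.x₁ := by exact_mod_cast hv₁
  have hvC₂ : (v : ℂ) ≠ P.x₂ := by exact_mod_cast hv₂
  have hc : ContinuousAt (fun w => P.map w / w) (v : ℂ) :=
    (P.continuousAt_map hvC₁ hvC₂).div continuousAt_id (by simpa using hv)
  have := h.tendsto_atom hv₁ hv₂ hq hx (hc.tendsto.mono_left nhdsWithin_le_nhds)
  rw [P.map_ofReal, hx] at this
  have h' : ((c * F.real {0} : ℝ) : ℂ) = ((c - 1 : ℝ) : ℂ) := by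
    push_cast; rw [this]; simp
  exact_mod_cast h'

lemma atom_of_map_zero (h : IsSubordinated c P F) (hx₁ : P.x₁ ≠ 0) (hx₂ : P.x₂ ≠ 0)
    (hq : P.realSlope 0 < 1) (hx : P.realMap 0 = 0) :
    c * F.real {0} = c - P.realSlope 0 := by
  have h₁ : (P.x₁ : ℂ) ≠ 0 := by exact_mod_cast hx₁
  have h₂ : (P.x₂ : ℂ) ≠ 0 := by exact_mod_cast hx₂
  have hc : ContinuousAt (fun w : ℂ => 1 - P.k₁ / ((w - P.x₁) * (0 - P.x₁))
      - P.k₂ / ((w - P.x₂) * (0 - P.x₂))) 0 := by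
    have : ((0 : ℂ) - P.x₁) * (0 - P.x₁) ≠ 0 := by simpa using h₁
    have : ((0 : ℂ) - P.x₂) * (0 - P.x₂) ≠ 0 := by simpa using h₂
    fun_prop (disch := assumption)
  have hlim : Tendsto (fun w => P.map w / w) (𝓝[≠] ((0 : ℝ) : ℂ))
      (𝓝 ((1 - P.realSlope 0 : ℝ) : ℂ)) := by
    rw [Complex.ofReal_zero]
    have e : (1 : ℂ) - P.k₁ / (((0 : ℂ) - P.x₁) * (0 - P.x₁))
      - P.k₂ / (((0 : ℂ) - P.x₂) * (0 - P.x₂)) = ((1 - P.realSlope 0 : ℝ) : ℂ) := by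
      simp only [TwoPoleMap.realSlope]
      push_cast
      ring
    rw [← e]
    refine (hc.tendsto.mono_left nhdsWithin_le_nhds).congr' ?_
    filter_upwards [self_mem_nhdsWithin,
      nhdsWithin_le_nhds (isOpen_ne.mem_nhds h₁.symm),
      nhdsWithin_le_nhds (isOpen_ne.mem_nhds h₂.symm)]
      with w hw hw₁ hw₂
    have hw0 : w ≠ 0 := hw
    have h0 : P.map 0 = 0 := by
      have := P.map_ofReal 0
      rwa [hx, Complex.ofReal_zero] at this
    have := P.map_sub_map hw₁ hw₂ h₁.symm h₂.symm
    rw [h0, sub_zero, sub_zero] at this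
    rw [this, mul_div_cancel_left₀ _ hw0]
  have := h.tendsto_atom hx₁.symm hx₂.symm hq hx hlim
  have h' : ((c * F.real {0} : ℝ) : ℂ) = ((c - P.realSlope 0 : ℝ) : ℂ) := by
    push_cast; rw [this]; push_cast; ring
  exact_mod_cast h'

/-- `G` is continuous and real at `x`, so as `z` descends to `x` the reciprocals `w⁻¹` converge to a
real `m`; the point sought is `v = m⁻¹`. -/
lemma exists_realMap_eq_of_notMem_support (h : IsSubordinated c P F) {x : ℝ}
    (hx : x ∉ F.support) (hx0 : x ≠ 0) :
    ∃ v : ℝ, v ≠ P.x₁ ∧ v ≠ P.x₂ ∧ P.realSlope v ≤ 1 ∧ P.realMap v = x := by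
  obtain ⟨hF, hw⟩ := h
  choose! w hwim hwz hwG using hw
  let u : ℕ → ℂ := fun n => x + (1 / ((n : ℝ) + 1) : ℝ) * Complex.I
  have huim : ∀ n, 0 < (u n).im := fun n => by
    simp only [u, Complex.add_im, Complex.ofReal_im, Complex.im_ofReal_mul, Complex.I_im]
    positivity
  have hu : Tendsto u atTop (𝓝 x) := by
    have h0 : Tendsto (fun n : ℕ => ((1 / ((n : ℝ) + 1) : ℝ) : ℂ)) atTop (𝓝 ((0 : ℝ) : ℂ)) :=
      (Complex.continuous_ofReal.tendsto 0).comp tendsto_one_div_add_atTop_nhds_zero_nat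
    have h1 := (h0.mul_const Complex.I).const_add (x : ℂ)
    rwa [Complex.ofReal_zero, zero_mul, add_zero] at h1
  set m : ℝ := (1 - c) / x + c * ∫ y, 1 / (x - y) ∂F with hm
  have hcont : ContinuousAt (cauchyTransform F) x :=
    (differentiableAt_cauchyTransform F fun y hy hyx => hx (by
      rw [← Complex.ofReal_inj.1 hyx]; exact hy)).continuousAt
  have hmlim : Tendsto (fun n => (w (u n))⁻¹) atTop (𝓝 (m : ℂ)) := by
    have h1 : ((m : ℝ) : ℂ) = (1 - (c : ℂ)) / x + c * cauchyTransform F x := by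
      rw [cauchyTransform_ofReal, hm]; push_cast; rfl
    rw [h1]
    refine Tendsto.congr (fun n => (hwG _ (huim n)).symm) ?_
    refine (tendsto_const_nhds.div hu (by exact_mod_cast hx0)).add
      ((hcont.tendsto.comp hu).const_mul _)
  have hw0 : ∀ n, w (u n) ≠ 0 := fun n h0 => by
    have := hwim _ (huim n); rw [h0] at this; simp at this
  have hne : ∀ n (y : ℝ), w (u n) - y ≠ 0 := fun n y => sub_ofReal_ne_zero (hwim _ (huim n)) y
  -- If `m = 0`, then `w` tends to infinity, and dividing `P(w) = z` by `w` gives `1 = 0` in the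
  -- limit.
  have hm0 : m ≠ 0 := by
    intro hm0
    rw [hm0, Complex.ofReal_zero] at hmlim
    have hL : Tendsto (fun n => u n * (w (u n))⁻¹) atTop (𝓝 0) := by
      simpa using hu.mul hmlim
    have hR : Tendsto (fun n => 1 + P.C * (w (u n))⁻¹
        + P.k₁ * ((w (u n))⁻¹ ^ 2 / (1 - P.x₁ * (w (u n))⁻¹))
        + P.k₂ * ((w (u n))⁻¹ ^ 2 / (1 - P.x₂ * (w (u n))⁻¹))) atTop (𝓝 1) := by
      have hc : ContinuousAt (fun m : ℂ => 1 + P.C * m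
        + P.k₁ * (m ^ 2 / (1 - P.x₁ * m)) + P.k₂ * (m ^ 2 / (1 - P.x₂ * m))) 0 := by
        have h1 : (1 : ℂ) - P.x₁ * 0 ≠ 0 := by simp
        have h2 : (1 : ℂ) - P.x₂ * 0 ≠ 0 := by simp
        fun_prop (disch := assumption)
      have := hc.tendsto.comp hmlim
      simpa [Function.comp_def] using this
    refine one_ne_zero (tendsto_nhds_unique hR (hL.congr fun n => ?_))
    have h0 := hw0 n
    have h1 := hne n P.x₁
    have h2 := hne n P.x₂
    have e : ∀ y : ℝ, w (u n) - y ≠ 0 → (w (u n))⁻¹ ^ 2 / (1 - y * (w (u n))⁻¹)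
        = 1 / (w (u n) - y) * (w (u n))⁻¹ := fun y hy => by
      have : 1 - (y : ℂ) * (w (u n))⁻¹ ≠ 0 := by
        intro hcon
        apply hy
        field_simp at hcon
        simpa using hcon
      rw [div_eq_iff this]
      field_simp
    rw [e _ h1, e _ h2]
    nth_rw 1 [← hwz _ (huim n)]
    unfold TwoPoleMap.map
    field_simp
  have hwlim : Tendsto (fun n => w (u n)) atTop (𝓝 ((m⁻¹ : ℝ) : ℂ)) := by
    have := hmlim.inv₀ (by exact_mod_cast hm0)
    simpa using this
  -- Slope below one keeps `w` at a fixed distance from both poles, so the limit is not a pole.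
  have hfar : ∀ n, P.k₁ ≤ Complex.normSq (w (u n) - P.x₁) ∧
      P.k₂ ≤ Complex.normSq (w (u n) - P.x₂) := fun n => by
    have hs := P.slope_lt_one (hwim _ (huim n)) (by rw [hwz _ (huim n)]; exact huim n)
    have p1 := Complex.normSq_pos.2 (hne n P.x₁)
    have p2 := Complex.normSq_pos.2 (hne n P.x₂)
    unfold TwoPoleMap.slope at hs
    have q1 := div_pos P.k₁_pos p1
    have q2 := div_pos P.k₂_pos p2
    exact ⟨((div_lt_one p1).1 (by linarith)).le, ((div_lt_one p2).1 (by linarith)).le⟩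
  have hlim : ∀ y : ℝ, Tendsto (fun n => Complex.normSq (w (u n) - y)) atTop
      (𝓝 ((m⁻¹ - y) ^ 2)) := fun y => by
    have := (Complex.continuous_normSq.tendsto _).comp (hwlim.sub_const (y : ℂ))
    rwa [← Complex.ofReal_sub, Complex.normSq_ofReal, ← sq] at this
  have hv₁ : m⁻¹ ≠ P.x₁ := fun hcon => by
    have := ge_of_tendsto' (hlim P.x₁) fun n => (hfar n).1
    rw [hcon] at this; simp at this; linarith [P.k₁_pos]
  have hv₂ : m⁻¹ ≠ P.x₂ := fun hcon => by
    have := ge_of_tendsto' (hlim P.x₂) fun n => (hfar n).2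
    rw [hcon] at this; simp at this; linarith [P.k₂_pos]
  have hvC₁ : ((m⁻¹ : ℝ) : ℂ) ≠ P.x₁ := by exact_mod_cast hv₁
  have hvC₂ : ((m⁻¹ : ℝ) : ℂ) ≠ P.x₂ := by exact_mod_cast hv₂
  refine ⟨m⁻¹, hv₁, hv₂, ?_, ?_⟩
  · rw [← P.slope_ofReal]
    exact le_of_tendsto' ((P.continuousAt_slope hvC₁ hvC₂).tendsto.comp hwlim) fun n =>
      (P.slope_lt_one (hwim _ (huim n)) (by rw [hwz _ (huim n)]; exact huim n)).le
  · have h1 := (P.continuousAt_map hvC₁ hvC₂).tendsto.comp hwlim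
    rw [P.map_ofReal] at h1
    have h2 : Tendsto (P.map ∘ fun n => w (u n)) atTop (𝓝 (x : ℂ)) :=
      hu.congr fun n => (hwz _ (huim n)).symm
    exact_mod_cast tendsto_nhds_unique h1 h2

end IsSubordinated

/-! ### Increasing branches of the map on the real line -/

namespace TwoPoleMap

variable (P : TwoPoleMap)

lemma realMap_sub_realMap {u v : ℝ} (hu₁ : u ≠ P.x₁) (hu₂ : u ≠ P.x₂) (hv₁ : v ≠ P.x₁)
    (hv₂ : v ≠ P.x₂) :
    P.realMap u - P.realMap v = (u - v) * (1 - P.k₁ / ((u - P.x₁) * (v - P.x₁))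
      - P.k₂ / ((u - P.x₂) * (v - P.x₂))) := by
  have := sub_ne_zero.2 hu₁
  have := sub_ne_zero.2 hu₂
  have := sub_ne_zero.2 hv₁
  have := sub_ne_zero.2 hv₂
  unfold realMap
  field_simp
  ring

lemma strictMonoOn_realSlope (h : P.x₁ < P.x₂) : StrictMonoOn P.realSlope (Iio P.x₁) := by
  intro u hu v hv huv
  simp only [mem_Iio] at hu hv
  have := P.k₁_pos
  have := P.k₂_pos
  unfold realSlope
  have h1 : (v - P.x₁) ^ 2 < (u - P.x₁) ^ 2 := by nlinarith
  have h2 : (v - P.x₂) ^ 2 < (u - P.x₂) ^ 2 := by nlinarith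
  have h3 : 0 < (v - P.x₁) ^ 2 := by nlinarith
  have h4 : 0 < (v - P.x₂) ^ 2 := by nlinarith
  gcongr

lemma continuousOn_realSlope (h : P.x₁ < P.x₂) : ContinuousOn P.realSlope (Iio P.x₁) := by
  unfold realSlope
  refine ContinuousOn.add (ContinuousOn.div (by fun_prop) (by fun_prop) fun x hx => ?_)
    (ContinuousOn.div (by fun_prop) (by fun_prop) fun x hx => ?_) <;>
  · simp only [mem_Iio] at hx
    exact pow_ne_zero 2 (by linarith)

lemma continuousOn_realMap (h : P.x₁ < P.x₂) : ContinuousOn P.realMap (Iio P.x₁) := by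
  unfold realMap
  refine ContinuousOn.add (ContinuousOn.add (by fun_prop)
    (ContinuousOn.div (by fun_prop) (by fun_prop) fun x hx => ?_))
    (ContinuousOn.div (by fun_prop) (by fun_prop) fun x hx => ?_) <;>
  · simp only [mem_Iio] at hx
    linarith

lemma realMap_lt_add (h : P.x₁ < P.x₂) {v : ℝ} (hv : v < P.x₁) : P.realMap v < v + P.C := by
  have h1 := div_neg_of_pos_of_neg P.k₁_pos (sub_neg.2 hv)
  have h2 := div_neg_of_pos_of_neg P.k₂_pos (sub_neg.2 (hv.trans h))
  unfold realMap
  linarith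

lemma div_mul_le {k a b : ℝ} (hk : 0 ≤ k) : k / (a * b) ≤ (k / a ^ 2 + k / b ^ 2) / 2 := by
  simp only [div_eq_mul_inv, mul_inv, ← inv_pow]
  nlinarith [mul_nonneg hk (sq_nonneg (a⁻¹ - b⁻¹))]

lemma realMap_le_realMap {u v : ℝ} (hu₁ : u ≠ P.x₁) (hu₂ : u ≠ P.x₂) (hv₁ : v ≠ P.x₁)
    (hv₂ : v ≠ P.x₂) (hu : P.realSlope u ≤ 1) (hv : P.realSlope v ≤ 1) (huv : u ≤ v) :
    P.realMap u ≤ P.realMap v := by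
  have h := P.realMap_sub_realMap hv₁ hv₂ hu₁ hu₂
  have h1 := div_mul_le (a := v - P.x₁) (b := u - P.x₁) P.k₁_pos.le
  have h2 := div_mul_le (a := v - P.x₂) (b := u - P.x₂) P.k₂_pos.le
  unfold realSlope at hu hv
  have : 0 ≤ (v - u) * (1 - P.k₁ / ((v - P.x₁) * (u - P.x₁))
      - P.k₂ / ((v - P.x₂) * (u - P.x₂))) := mul_nonneg (by linarith) (by linarith)
  linarith

/-- The point left of the poles at which the slope is one, with the increasing branch that ends
there. -/
lemma exists_left_edge (h : P.x₁ < P.x₂) :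
    ∃ α < P.x₁, P.realSlope α = 1 ∧ (∀ v < P.x₁, P.realSlope v ≤ 1 → v ≤ α) ∧
      (∀ v < α, P.realSlope v < 1) ∧ (∀ v ≤ α, P.realMap v ≤ P.realMap α) ∧
      (∀ y < P.realMap α, ∃ v < α, P.realMap v = y) ∧ P.realMap α < α + P.C := by
  have hk₁ := P.k₁_pos
  have hk₂ := P.k₂_pos
  have hs1 : 0 < √P.k₁ := Real.sqrt_pos.2 hk₁
  have hs2 : √P.k₁ < √(P.k₁ + P.k₂) := Real.sqrt_lt_sqrt hk₁.le (by linarith)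
  -- These two points bracket the solution of `realSlope = 1`: at `l` both squared distances are at
  -- least `k₁ + k₂`, and at `m` the first term alone equals `1`.
  set l := P.x₁ - √(P.k₁ + P.k₂) with hl
  set m := P.x₁ - √P.k₁ with hm
  have hsub : Icc l m ⊆ Iio P.x₁ := fun x hx => by
    have := hx.2
    simp only [mem_Iio]; linarith
  have hl1 : P.realSlope l ≤ 1 := by
    have e1 : (l - P.x₁) ^ 2 = P.k₁ + P.k₂ := by
      rw [hl, sub_sub_cancel_left, neg_sq, Real.sq_sqrt (by positivity)]
    have e2 : P.k₁ + P.k₂ ≤ (l - P.x₂) ^ 2 := by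
      rw [← e1]; nlinarith
    unfold realSlope
    calc P.k₁ / (l - P.x₁) ^ 2 + P.k₂ / (l - P.x₂) ^ 2
        ≤ P.k₁ / (P.k₁ + P.k₂) + P.k₂ / (P.k₁ + P.k₂) := by
          rw [e1]; gcongr
      _ = 1 := by field_simp
  have hm1 : 1 ≤ P.realSlope m := by
    have e1 : (m - P.x₁) ^ 2 = P.k₁ := by
      rw [hm, sub_sub_cancel_left, neg_sq, Real.sq_sqrt hk₁.le]
    unfold realSlope
    rw [e1, div_self hk₁.ne']
    linarith [div_nonneg hk₂.le (sq_nonneg (m - P.x₂))]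
  obtain ⟨α, hα, hα1⟩ := intermediate_value_Icc (by linarith : l ≤ m)
    ((P.continuousOn_realSlope h).mono hsub) ⟨hl1, hm1⟩
  have hαx : α < P.x₁ := hsub hα
  have hmono := P.strictMonoOn_realSlope h
  have hlt : ∀ v < α, P.realSlope v < 1 := fun v hv => by
    rw [← hα1]; exact hmono (hv.trans hαx) hαx hv
  have hle : ∀ v ≤ α, P.realMap v ≤ P.realMap α := fun v hv => by
    have hvs : P.realSlope v ≤ 1 := by
      rcases hv.eq_or_lt with rfl | hv
      · exact hα1.le
      · exact (hlt v hv).le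
    exact P.realMap_le_realMap (by linarith) (by linarith) (by linarith) (by linarith) hvs hα1.le hv
  refine ⟨α, hαx, hα1, fun v hv hv1 => ?_, hlt, hle, fun y hy => ?_, P.realMap_lt_add h hαx⟩
  · by_contra! hcon
    have := hmono (show α ∈ Iio P.x₁ from hαx) hv hcon
    linarith
  · have hαC := P.realMap_lt_add h hαx
    -- Left of the poles `P(v) < v + C`, so `P(y - C) < y`, and `y` is attained between `y - C` and
    -- `α`.
    have hyα : y - P.C ≤ α := by linarith
    obtain ⟨v, hv, hvy⟩ := intermediate_value_Icc hyα
      ((P.continuousOn_realMap h).mono fun x hx => lt_of_le_of_lt hx.2 hαx)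
      (show y ∈ Icc _ _ from
        ⟨by have := P.realMap_lt_add h (lt_of_le_of_lt hyα hαx); linarith, hy.le⟩)
    refine ⟨v, lt_of_le_of_ne hv.2 ?_, hvy⟩
    rintro rfl
    linarith

/-- The map conjugated by `w ↦ -w`. -/
def reflect : TwoPoleMap where
  C := -P.C
  k₁ := P.k₂
  k₂ := P.k₁
  x₁ := -P.x₂
  x₂ := -P.x₁
  k₁_pos := P.k₂_pos
  k₂_pos := P.k₁_pos

lemma realMap_reflect (v : ℝ) : P.reflect.realMap v = -P.realMap (-v) := by
  have e : ∀ k x : ℝ, k / (v + x) = -(k / (-v - x)) := fun k x => by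
    rw [← div_neg]; congr 1; ring
  simp only [realMap, reflect, sub_neg_eq_add, e]
  ring

lemma realSlope_reflect (v : ℝ) : P.reflect.realSlope v = P.realSlope (-v) := by
  have e : ∀ x : ℝ, (v + x) ^ 2 = (-v - x) ^ 2 := fun x => by ring
  simp only [realSlope, reflect, sub_neg_eq_add, e]
  ring

/-- The point right of the poles at which the slope is one, with the increasing branch that starts
there. -/
lemma exists_right_edge (h : P.x₁ < P.x₂) :
    ∃ β > P.x₂, P.realSlope β = 1 ∧ (∀ v > P.x₂, P.realSlope v ≤ 1 → β ≤ v) ∧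
      (∀ v > β, P.realSlope v < 1) ∧ (∀ v ≥ β, P.realMap β ≤ P.realMap v) ∧
      (∀ y > P.realMap β, ∃ v > β, P.realMap v = y) ∧ β + P.C < P.realMap β := by
  obtain ⟨α, h1, h2, h3, h4, h5, h6, h7⟩ := P.reflect.exists_left_edge
    (show -P.x₂ < -P.x₁ by linarith)
  change α < -P.x₂ at h1
  simp only [realMap_reflect, realSlope_reflect] at *
  change ∀ v < -P.x₂, _ at h3
  change _ < α + -P.C at h7
  refine ⟨-α, by linarith, h2, fun v hv hs => ?_, fun v hv => ?_, fun v hv => ?_, fun y hy => ?_,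
    by linarith⟩
  · have := h3 (-v) (by linarith) (by rwa [neg_neg]); linarith
  · have := h4 (-v) (by linarith); rwa [neg_neg] at this
  · have := h5 (-v) (by linarith); rw [neg_neg] at this; linarith
  · obtain ⟨v, hv, hvy⟩ := h6 (-y) (by linarith)
    exact ⟨-v, by linarith, by linarith⟩

/-- This is what closes the gap: between the poles, `(v - x₁)² < (x₂ - x₁)² < k₁`, so no increasing
piece lies there. -/
lemma one_lt_realSlope_of_mem_Ioo (hk : (P.x₂ - P.x₁) ^ 2 < P.k₁) {v : ℝ}
    (hv : v ∈ Ioo P.x₁ P.x₂) : 1 < P.realSlope v := by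
  obtain ⟨h1, h2⟩ := hv
  have h3 : 0 < (v - P.x₁) ^ 2 := by nlinarith
  have h4 : 1 < P.k₁ / (v - P.x₁) ^ 2 := by
    rw [lt_div_iff₀ h3]; nlinarith
  unfold realSlope
  linarith [div_nonneg P.k₂_pos.le (sq_nonneg (v - P.x₂))]

/-- `P(α) - P(0)` is `α` times `1 - ∑ k / ((α - x)(0 - x))`. As `0` is nearer to the poles than `α`,
the sum exceeds `realSlope α = 1`, so both factors are negative. -/
lemma realMap_pos_of_realSlope_eq_one (h₁ : 0 < P.x₁) (h₂ : 0 < P.x₂) (h0 : P.realMap 0 = 0)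
    {α : ℝ} (hα : α < 0) (hα1 : P.realSlope α = 1) : 0 < P.realMap α := by
  have h := P.realMap_sub_realMap (u := α) (v := 0) (by linarith) (by linarith) h₁.ne h₂.ne
  have e : ∀ k x : ℝ, 0 < k → 0 < x → k / (α - x) ^ 2 < k / ((α - x) * (0 - x)) :=
    fun k x hk hx => by
      have : 0 < (α - x) * (0 - x) := mul_pos_of_neg_of_neg (by linarith) (by linarith)
      exact div_lt_div_of_pos_left hk this (by nlinarith)
  have e1 := e _ _ P.k₁_pos h₁
  have e2 := e _ _ P.k₂_pos h₂
  unfold realSlope at hα1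
  rw [h0, sub_zero, sub_zero] at h
  rw [h]
  exact mul_pos_of_neg_of_neg hα (by linarith)

end TwoPoleMap

/-! ### The support is one interval, up to the point `0` -/

/-- The interval is `[P(α), P(β)]` for the outer points of slope one. The value `realSlope 0` places
`0` relative to `α`: at slope one `α = 0`, and above one `α < 0 < P(α)`, so the left branch has a
zero of its own. -/
lemma IsSubordinated.exists_support_eq {c : ℝ} {P : TwoPoleMap} {F : Measure ℝ}
    (h : IsSubordinated c P F) (hc : 0 < c) (hx : P.x₁ < P.x₂) (hx₁ : 0 < P.x₁)
    (hk : (P.x₂ - P.x₁) ^ 2 < P.k₁) (h0 : P.realMap 0 = 0) :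
    ∃ a b : ℝ, a < b ∧ (F.restrict {0}ᶜ).support = Icc a b ∧ Icc a b ⊆ F.support ∧
      F.support ⊆ insert 0 (Icc a b) ∧ (P.realSlope 0 = 1 → a = 0) ∧
      (1 < P.realSlope 0 → ∃ v < 0, P.realSlope v < 1 ∧ P.realMap v = 0) := by
  obtain ⟨α, hα, hα1, hαle, hαlt, hαmax, hαsurj, hαC⟩ := P.exists_left_edge hx
  obtain ⟨β, hβ, hβ1, hβle, hβlt, hβmin, hβsurj, hβC⟩ := P.exists_right_edge hx
  have hab : P.realMap α < P.realMap β := by linarith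
  have hα0 : P.realSlope 0 ≤ 1 → 0 ≤ α := hαle 0 hx₁
  have hα0' : 1 < P.realSlope 0 → α < 0 := fun hs => by
    by_contra! hcon
    rcases hcon.eq_or_lt with h | h
    · rw [h, hα1] at hs; exact lt_irrefl _ hs
    · linarith [hαlt 0 h]
  have hpos : 1 < P.realSlope 0 → 0 < P.realMap α := fun hs =>
    P.realMap_pos_of_realSlope_eq_one hx₁ (hx₁.trans hx) h0 (hα0' hs) hα1
  have ha0 : 0 ≤ P.realMap α := by
    rcases le_or_gt (P.realSlope 0) 1 with hs | hs
    · rw [← h0]; exact hαmax 0 (hα0 hs)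
    · exact (hpos hs).le
  have hin : Ioo (P.realMap α) (P.realMap β) ⊆ F.support := by
    intro x hxI
    by_contra hcon
    obtain ⟨v, hv₁, hv₂, hvs, rfl⟩ :=
      h.exists_realMap_eq_of_notMem_support hcon (ne_of_gt (ha0.trans_lt hxI.1))
    rcases lt_or_gt_of_ne hv₁ with h1 | h1
    · exact absurd (hαmax v (hαle v h1 hvs)) (not_le.2 hxI.1)
    · rcases lt_or_gt_of_ne hv₂ with h2 | h2
      · exact absurd hvs (not_le.2 (P.one_lt_realSlope_of_mem_Ioo hk ⟨h1, h2⟩))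
      · exact absurd (hβmin v (hβle v h2 hvs)) (not_le.2 hxI.2)
  have hnull : ∀ v : ℝ, v ≠ P.x₁ → v ≠ P.x₂ → P.realSlope v < 1 → P.realMap v ≠ 0 →
      P.realMap v ∉ F.support := fun v h1 h2 h3 h4 => by
    have hv : v ≠ 0 := by rintro rfl; exact h4 h0
    obtain ⟨δ, hδ, hF⟩ := h.exists_measure_Icc_eq_zero hc h1 h2 h3 hv h4
    rw [Measure.notMem_support_iff_exists]
    exact ⟨_, Icc_mem_nhds (by linarith) (by linarith), hF⟩
  have hout : F.support ⊆ insert 0 (Icc (P.realMap α) (P.realMap β)) := by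
    intro x hxs
    by_contra hcon
    simp only [mem_insert_iff, mem_Icc, not_or, not_and_or, not_le] at hcon
    obtain ⟨hx0, hx' | hx'⟩ := hcon
    · obtain ⟨v, hv, rfl⟩ := hαsurj x hx'
      exact hnull v (by linarith) (by linarith) (hαlt v hv) hx0 hxs
    · obtain ⟨v, hv, rfl⟩ := hβsurj x hx'
      exact hnull v (by linarith) (by linarith) (hβlt v hv) hx0 hxs
  refine ⟨P.realMap α, P.realMap β, hab, Subset.antisymm ?_ ?_, ?_, hout, ?_, ?_⟩
  · refine Measure.support_subset_of_isClosed isClosed_Icc ?_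
    rw [mem_ae_iff, Measure.restrict_apply measurableSet_Icc.compl]
    refine measure_mono_null ?_ (Measure.measure_compl_support (μ := F))
    rintro x ⟨hx1, hx2⟩ hxs
    rcases hout hxs with h | h
    · exact hx2 h
    · exact hx1 h
  · rw [← closure_Ioo hab.ne]
    refine closure_minimal (fun x hxI => ?_) Measure.isClosed_support
    exact Measure.interior_inter_support ⟨by
      rw [isOpen_compl_singleton.interior_eq]
      exact ne_of_gt (ha0.trans_lt hxI.1), hin hxI⟩
  · rw [← closure_Ioo hab.ne]
    exact closure_minimal hin Measure.isClosed_support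
  · intro hs
    have h1 := hα0 hs.le
    rcases h1.eq_or_lt with h1 | h1
    · rw [← h1, h0]
    · linarith [hαlt 0 h1]
  · intro hs
    obtain ⟨v, hv, hv0⟩ := hαsurj 0 (hpos hs)
    exact ⟨v, hv.trans (hα0' hs), hαlt v hv, hv0⟩

lemma componentCount_Icc {a b : ℝ} (h : a ≤ b) : componentCount (Icc a b) = 1 := by
  have : Nonempty (Icc a b) := ⟨⟨a, left_mem_Icc.2 h⟩⟩
  have : PreconnectedSpace (Icc a b) := Subtype.preconnectedSpace isPreconnected_Icc
  rw [componentCount, ENat.card_eq_one_iff_unique, unique_iff_subsingleton_and_nonempty]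
  exact ⟨inferInstance, inferInstance⟩

lemma componentGap_Icc {a b : ℝ} (h : a ≤ b) : componentGap (Icc a b) = 0 := by
  rw [componentGap, if_pos (componentCount_Icc h)]

/-! ### The Marchenko–Pastur equation as `P(w) = z` -/

lemma integral_populationLaw {r s t : ℝ} (hr0 : 0 ≤ r) (hr1 : r ≤ 1) (f : ℝ → ℂ) :
    ∫ x, f x ∂populationLaw r s t = (1 - r) * f t + r * f (s + t) := by
  rw [populationLaw, integral_add_measure, integral_smul_measure, integral_smul_measure,
    integral_dirac, integral_dirac, ENNReal.toReal_ofReal (by linarith), ENNReal.toReal_ofReal hr0]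
  · simp
  · exact (integrable_dirac (by simp)).smul_measure ENNReal.ofReal_ne_top
  · exact (integrable_dirac (by simp)).smul_measure ENNReal.ofReal_ne_top

/-- The functional inverse of the reciprocal companion transform for the population law `H_t`. -/
def marchenkoPasturMap {c r s t : ℝ} (hc : 0 < c) (hr0 : 0 < r) (hr1 : r < 1) (hs : 0 < s)
    (ht : 0 < t) : TwoPoleMap where
  C := c * ((1 - r) * t + r * (s + t))
  k₁ := c * (1 - r) * t ^ 2
  k₂ := c * r * (s + t) ^ 2
  x₁ := t
  x₂ := s + t
  k₁_pos := mul_pos (mul_pos hc (by linarith)) (by positivity)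
  k₂_pos := by positivity

section

variable {c r s t : ℝ} (hc : 0 < c) (hr0 : 0 < r) (hr1 : r < 1) (hs : 0 < s) (ht : 0 < t)

/-- Stated as an identity between defects, so that either equation yields the other. -/
lemma marchenkoPasturMap_defect {w z G : ℂ} (hw : 0 < w.im) (hz : z ≠ 0)
    (h : w⁻¹ = (1 - (c : ℂ)) / z + (c : ℂ) * G) :
    G - ((1 - r) * (1 / (z - (t : ℂ) * (1 - (c : ℂ) + (c : ℂ) * z * G)))
      + r * (1 / (z - ((s + t : ℝ) : ℂ) * (1 - (c : ℂ) + (c : ℂ) * z * G))))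
      = (z - (marchenkoPasturMap hc hr0 hr1 hs ht).map w) / (c * z * w) := by
  have hw0 : w ≠ 0 := by rintro rfl; simp at hw
  have hc0 : (c : ℂ) ≠ 0 := by exact_mod_cast hc.ne'
  have h1 : 1 - (c : ℂ) + (c : ℂ) * z * G = z / w := by
    rw [div_eq_mul_inv, h]; field_simp
  have hG : G = (z / w - (1 - c)) / (c * z) := by
    rw [← h1]; field_simp; ring
  have e : ∀ x : ℝ, 1 / (z - (x : ℂ) * (z / w)) = w / (z * (w - x)) := fun x => by
    have := sub_ofReal_ne_zero hw x
    have h2 : z - (x : ℂ) * (z / w) = z * (w - x) / w := by field_simp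
    rw [h2, one_div_div]
  rw [h1, e, e, hG]
  have n1 := sub_ofReal_ne_zero hw t
  have n2 := sub_ofReal_ne_zero hw (s + t)
  simp only [TwoPoleMap.map, marchenkoPasturMap]
  push_cast at n2 ⊢
  field_simp
  ring

lemma isMPLaw_iff (F : Measure ℝ) :
    IsMPLaw c (populationLaw r s t) F ↔
      IsSubordinated c (marchenkoPasturMap hc hr0 hr1 hs ht) F := by
  constructor
  · rintro ⟨hF, hdom, heq⟩
    refine ⟨hF, fun z hz => ?_⟩
    have hz0 : z ≠ 0 := by rintro rfl; simp at hz
    have hm := hdom z hz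
    set m := (1 - (c : ℂ)) / z + (c : ℂ) * cauchyTransform F z with hmd
    have hm0 : m ≠ 0 := by intro h0; rw [h0] at hm; simp at hm
    have hw : 0 < (m⁻¹).im := by
      rw [Complex.inv_im]
      exact div_pos (by linarith) (Complex.normSq_pos.2 hm0)
    refine ⟨m⁻¹, hw, ?_, inv_inv m⟩
    have := marchenkoPasturMap_defect hc hr0 hr1 hs ht hw hz0 (by rw [inv_inv])
    rw [← integral_populationLaw hr0.le hr1.le
      (fun x => 1 / (z - (x : ℂ) * (1 - (c : ℂ) + (c : ℂ) * z * cauchyTransform F z))),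
      ← heq z hz, sub_self] at this
    have hc0 : (c : ℂ) ≠ 0 := by exact_mod_cast hc.ne'
    have h2 := (div_eq_zero_iff.1 this.symm).resolve_right
      (mul_ne_zero (mul_ne_zero hc0 hz0) (inv_ne_zero hm0))
    exact (sub_eq_zero.1 h2).symm
  · rintro ⟨hF, hw⟩
    refine ⟨hF, fun z hz => ?_, fun z hz => ?_⟩
    · obtain ⟨w, hw, -, h⟩ := hw z hz
      rw [← h, Complex.inv_im]
      have hw0 : w ≠ 0 := by rintro rfl; simp at hw
      exact div_neg_of_neg_of_pos (by linarith) (Complex.normSq_pos.2 hw0)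
    · have hz0 : z ≠ 0 := by rintro rfl; simp at hz
      obtain ⟨w, hw, hwz, h⟩ := hw z hz
      have := marchenkoPasturMap_defect hc hr0 hr1 hs ht hw hz0 h
      rw [hwz, sub_self, zero_div] at this
      rw [integral_populationLaw hr0.le hr1.le
        (fun x => 1 / (z - (x : ℂ) * (1 - (c : ℂ) + (c : ℂ) * z * cauchyTransform F z)))]
      exact sub_eq_zero.1 this

lemma marchenkoPasturMap_realMap_zero : (marchenkoPasturMap hc hr0 hr1 hs ht).realMap 0 = 0 := by
  simp only [TwoPoleMap.realMap, marchenkoPasturMap]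
  have : s + t ≠ 0 := by positivity
  rw [zero_sub, zero_sub]
  field_simp
  ring

lemma marchenkoPasturMap_realSlope_zero :
    (marchenkoPasturMap hc hr0 hr1 hs ht).realSlope 0 = c := by
  simp only [TwoPoleMap.realSlope, marchenkoPasturMap]
  have : s + t ≠ 0 := by positivity
  rw [zero_sub, zero_sub]
  field_simp
  ring

end

/-! ### Existence: finitely supported approximations -/

lemma exists_orthogonal_eigenvectors {n : Type*} [Fintype n] [DecidableEq n] {A : Matrix n n ℝ}
    (hA : A.IsHermitian) :
    ∃ (U : Matrix n n ℝ) (lam : n → ℝ), (∀ i j, ∑ l, U i l * U j l = if i = j then 1 else 0) ∧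
      ∀ i l, ∑ j, A i j * U j l = lam l * U i l := by
  refine ⟨hA.eigenvectorUnitary, hA.eigenvalues, fun i j => ?_, fun i l => ?_⟩
  · have h := congrFun (congrFun (Matrix.mem_unitaryGroup_iff.1 hA.eigenvectorUnitary.2) i) j
    rw [Matrix.mul_apply, Matrix.one_apply] at h
    exact h
  · have h := congrFun (hA.mulVec_eigenvectorBasis l) i
    exact h

/-- A diagonal matrix with the diagonal entries `y`, bordered by a row and a column. -/
noncomputable def arrowMatrix {ι : Type*} [DecidableEq ι] (a : ℝ) (q y : ι → ℝ) :
    Matrix (Option ι) (Option ι) ℝ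
  | none, none => a
  | none, some i => √(q i)
  | some i, none => √(q i)
  | some i, some j => if i = j then y i else 0

lemma isHermitian_arrowMatrix {ι : Type*} [DecidableEq ι] (a : ℝ) (q y : ι → ℝ) :
    (arrowMatrix a q y).IsHermitian := by
  ext i j
  cases i <;> cases j <;> simp only [Matrix.conjTranspose_apply, arrowMatrix, star_trivial]
  rename_i i j
  rcases eq_or_ne i j with rfl | h
  · rfl
  · rw [if_neg h, if_neg h.symm]

/-- The corner entry of the resolvent of a bordered diagonal matrix is the Cauchy transform of a
finitely supported probability measure. -/
lemma exists_partial_fractions {ι : Type*} [Fintype ι] (a : ℝ) {q : ι → ℝ} (y : ι → ℝ)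
    (hq : ∀ i, 0 ≤ q i) :
    ∃ ρ lam : Option ι → ℝ, (∀ l, 0 ≤ ρ l) ∧ ∑ l, ρ l = 1 ∧
      ∑ l, ρ l * lam l ^ 2 = a ^ 2 + ∑ i, q i ∧
      ∀ z : ℂ, 0 < z.im →
        1 / (z - a - ∑ i, (q i : ℂ) / (z - y i)) = ∑ l, (ρ l : ℂ) / (z - lam l) := by
  classical
  obtain ⟨U, lam, hU, hAU⟩ := exists_orthogonal_eigenvectors (isHermitian_arrowMatrix a q y)
  refine ⟨fun l => U none l * U none l, lam, fun l => mul_self_nonneg _, by simpa using hU none none,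
    ?_, fun z hz => ?_⟩
  -- The second moment is the corner entry of the squared matrix.
  · calc ∑ l, U none l * U none l * lam l ^ 2
        = ∑ l, (∑ j, arrowMatrix a q y none j * U j l) * ∑ k, arrowMatrix a q y none k * U k l := by
          refine Finset.sum_congr rfl fun l _ => ?_
          rw [hAU]; ring
      _ = ∑ l, ∑ j, ∑ k, arrowMatrix a q y none j * arrowMatrix a q y none k * (U j l * U k l) := by
          refine Finset.sum_congr rfl fun l _ => ?_
          rw [Finset.sum_mul_sum]
          exact Finset.sum_congr rfl fun j _ => Finset.sum_congr rfl fun k _ => by ring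
      _ = ∑ j, ∑ k, arrowMatrix a q y none j * arrowMatrix a q y none k * ∑ l, U j l * U k l := by
          rw [Finset.sum_comm]
          refine Finset.sum_congr rfl fun j _ => ?_
          rw [Finset.sum_comm]
          exact Finset.sum_congr rfl fun k _ => by rw [Finset.mul_sum]
      _ = a ^ 2 + ∑ i, q i := by
          simp only [hU, mul_ite, mul_one, mul_zero, Finset.sum_ite_eq, Finset.mem_univ, if_true,
            Fintype.sum_option, arrowMatrix, Real.mul_self_sqrt (hq _)]
          rw [sq]
  -- `x` is the resolvent applied to the corner basis vector. Eliminating the other coordinates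
  -- (Schur complement) gives the continued fraction for `x none`.
  · let x : Option ι → ℂ := fun i => ∑ l, (U none l : ℂ) * U i l / (z - lam l)
    have hres : ∀ i, z * x i - ∑ j, (arrowMatrix a q y i j : ℂ) * x j
        = if none = i then 1 else 0 := by
      intro i
      have h1 : ∑ j, (arrowMatrix a q y i j : ℂ) * x j
          = ∑ l, (lam l : ℂ) * ((U none l : ℂ) * U i l / (z - lam l)) := by
        simp only [x, Finset.mul_sum]
        rw [Finset.sum_comm]
        refine Finset.sum_congr rfl fun l _ => ?_
        have h2 : (lam l : ℂ) * U i l = ∑ j, (arrowMatrix a q y i j : ℂ) * U j l := by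
          exact_mod_cast (hAU i l).symm
        calc _ = (∑ j, (arrowMatrix a q y i j : ℂ) * U j l) * (U none l / (z - lam l)) := by
              rw [Finset.sum_mul]
              exact Finset.sum_congr rfl fun j _ => by ring
          _ = _ := by rw [← h2]; ring
      rw [h1]
      simp only [x]
      rw [Finset.mul_sum, ← Finset.sum_sub_distrib]
      have h3 : ∑ l, (U none l : ℂ) * U i l = if none = i then 1 else 0 := by
        have := hU none i
        split_ifs at this ⊢ <;> exact_mod_cast this
      rw [← h3]
      refine Finset.sum_congr rfl fun l _ => ?_
      have := sub_ofReal_ne_zero hz (lam l)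
      field_simp
    have hsome : ∀ i : ι, x (some i) = (√(q i) : ℝ) * x none / (z - y i) := fun i => by
      have h := hres (some i)
      have hz' := sub_ofReal_ne_zero hz (y i)
      rw [Fintype.sum_option] at h
      simp only [arrowMatrix, reduceCtorEq, if_false, apply_ite Complex.ofReal, Complex.ofReal_zero,
        ite_mul, zero_mul, Finset.sum_ite_eq, Finset.mem_univ, if_true] at h
      rw [eq_div_iff hz']
      linear_combination h
    have hnone := hres none
    rw [Fintype.sum_option] at hnone
    simp only [arrowMatrix, if_true, hsome] at hnone
    have hsq : ∀ i, ((√(q i) : ℝ) : ℂ) * ((√(q i) : ℝ) * x none / (z - y i))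
        = (q i : ℂ) / (z - y i) * x none := fun i => by
      have : ((√(q i) : ℝ) : ℂ) * (√(q i) : ℝ) = q i := by
        exact_mod_cast Real.mul_self_sqrt (hq i)
      rw [← this]; ring
    simp only [hsq, ← Finset.sum_mul] at hnone
    have hfin : (z - a - ∑ i, (q i : ℂ) / (z - y i)) * x none = 1 := by
      linear_combination hnone
    rw [one_div, ← eq_inv_of_mul_eq_one_right hfin]
    simp only [x]
    push_cast
    rfl

/-- On the upper half-plane, `f` is `z - a` minus the Cauchy transform of a finitely supported
measure of mass `K`. -/
def IsFiniteNevanlinna (a K : ℝ) (f : ℂ → ℂ) : Prop :=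
  ∃ (ι : Type) (_ : Fintype ι) (q y : ι → ℝ), (∀ i, 0 ≤ q i) ∧ ∑ i, q i = K ∧
    ∀ z : ℂ, 0 < z.im → f z = z - a - ∑ i, (q i : ℂ) / (z - y i)

namespace IsFiniteNevanlinna

variable {a K : ℝ} {f : ℂ → ℂ}

lemma im_le (h : IsFiniteNevanlinna a K f) {z : ℂ} (hz : 0 < z.im) : z.im ≤ (f z).im := by
  obtain ⟨ι, _, q, y, hq, -, hf⟩ := h
  have : (∑ i, (q i : ℂ) / (z - y i)).im ≤ 0 := by
    rw [Complex.im_sum]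
    refine Finset.sum_nonpos fun i _ => ?_
    rw [div_eq_mul_one_div, Complex.im_ofReal_mul, im_one_div_sub_ofReal]
    have := mul_nonneg (hq i) (div_nonneg hz.le (Complex.normSq_nonneg (z - y i)))
    linarith
  rw [hf z hz]
  simp only [Complex.sub_im, Complex.ofReal_im]
  linarith

lemma exists_weights (h : IsFiniteNevanlinna a K f) (x : ℝ) :
    ∃ (ι : Type) (_ : Fintype ι) (ρ lam : ι → ℝ), (∀ l, 0 ≤ ρ l) ∧ ∑ l, ρ l = 1 ∧
      ∑ l, ρ l * lam l ^ 2 = (a + x) ^ 2 + K ∧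
      ∀ z : ℂ, 0 < z.im → 1 / (f z - x) = ∑ l, (ρ l : ℂ) / (z - lam l) := by
  obtain ⟨ι, _, q, y, hq, hK, hf⟩ := h
  obtain ⟨ρ, lam, h1, h2, h3, h4⟩ := exists_partial_fractions (a + x) y hq
  refine ⟨Option ι, inferInstance, ρ, lam, h1, h2, by rw [h3, hK], fun z hz => ?_⟩
  rw [← h4 z hz, hf z hz]
  push_cast
  congr 1
  ring

lemma step (h : IsFiniteNevanlinna a K f) (b x₁ x₂ : ℝ) {k₁ k₂ : ℝ} (hk₁ : 0 ≤ k₁) (hk₂ : 0 ≤ k₂) :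
    IsFiniteNevanlinna b (k₁ + k₂)
      (fun z => z - b - (k₁ / (f z - x₁) + k₂ / (f z - x₂))) := by
  obtain ⟨ι₁, _, ρ₁, lam₁, hn₁, hs₁, -, hf₁⟩ := h.exists_weights x₁
  obtain ⟨ι₂, _, ρ₂, lam₂, hn₂, hs₂, -, hf₂⟩ := h.exists_weights x₂
  refine ⟨ι₁ ⊕ ι₂, inferInstance, Sum.elim (fun i => k₁ * ρ₁ i) (fun i => k₂ * ρ₂ i),
    Sum.elim lam₁ lam₂, ?_, ?_, fun z hz => ?_⟩
  · rintro (i | i)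
    · exact mul_nonneg hk₁ (hn₁ i)
    · exact mul_nonneg hk₂ (hn₂ i)
  · simp only [Fintype.sum_sum_type, Sum.elim_inl, Sum.elim_inr, ← Finset.mul_sum, hs₁, hs₂, mul_one]
  · simp only [Fintype.sum_sum_type, Sum.elim_inl, Sum.elim_inr, Complex.ofReal_mul, mul_div_assoc,
      ← Finset.mul_sum, ← hf₁ z hz, ← hf₂ z hz]
    simp only [mul_one_div]

/-- The tail bound is Chebyshev's inequality with second moment `a² + K`; it depends only on `a` and
`K`, which gives tightness along the iteration. -/
lemma exists_probabilityMeasure (h : IsFiniteNevanlinna a K f) :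
    ∃ F : ProbabilityMeasure ℝ, (∀ z : ℂ, 0 < z.im → cauchyTransform F z = 1 / f z) ∧
      ∀ R : ℝ, 0 < R → (F : Measure ℝ).real (Metric.closedBall 0 R)ᶜ ≤ (a ^ 2 + K) / R ^ 2 := by
  classical
  obtain ⟨ι, _, ρ, lam, hn, hs, hm, hf⟩ := h.exists_weights 0
  let μ : Measure ℝ := ∑ l, ENNReal.ofReal (ρ l) • Measure.dirac (lam l)
  have hreal : ∀ S : Set ℝ, MeasurableSet S → μ.real S = ∑ l, ρ l * S.indicator 1 (lam l) := by
    intro S hS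
    simp only [μ, measureReal_def, Measure.finsetSum_apply, Measure.smul_apply, smul_eq_mul]
    rw [ENNReal.toReal_sum fun l _ => ENNReal.mul_ne_top ENNReal.ofReal_ne_top (measure_ne_top _ _)]
    refine Finset.sum_congr rfl fun l _ => ?_
    rw [ENNReal.toReal_mul, ENNReal.toReal_ofReal (hn l), Measure.dirac_apply' _ hS]
    by_cases hl : lam l ∈ S <;> simp [hl]
  have hμ : IsProbabilityMeasure μ := by
    constructor
    simp only [μ, Measure.finsetSum_apply, Measure.smul_apply, smul_eq_mul, measure_univ, mul_one]
    rw [← ENNReal.ofReal_sum_of_nonneg fun l _ => hn l, hs, ENNReal.ofReal_one]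
  refine ⟨⟨μ, hμ⟩, fun z hz => ?_, fun R hR => ?_⟩
  · have h1 := hf z hz
    rw [Complex.ofReal_zero, sub_zero] at h1
    rw [h1]
    simp only [ProbabilityMeasure.coe_mk, cauchyTransform, μ]
    rw [integral_finsetSum_measure fun l _ =>
      (integrable_one_div_sub_ofReal _ hz).smul_measure ENNReal.ofReal_ne_top]
    refine Finset.sum_congr rfl fun l _ => ?_
    rw [integral_smul_measure, integral_dirac, ENNReal.toReal_ofReal (hn l), Complex.real_smul,
      mul_one_div]
  · rw [ProbabilityMeasure.coe_mk, hreal _ Metric.isClosed_closedBall.measurableSet.compl,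
      le_div_iff₀ (by positivity), Finset.sum_mul]
    rw [add_zero] at hm
    rw [← hm]
    refine Finset.sum_le_sum fun l _ => ?_
    rw [mul_assoc]
    refine mul_le_mul_of_nonneg_left ?_ (hn l)
    by_cases hl : lam l ∈ (Metric.closedBall (0 : ℝ) R)ᶜ
    · rw [indicator_of_mem hl, Pi.one_apply, one_mul]
      rw [mem_compl_iff, Metric.mem_closedBall, Real.dist_eq, sub_zero, not_le] at hl
      rw [← sq_abs (lam l)]
      gcongr
    · rw [indicator_of_notMem hl, zero_mul]
      positivity

end IsFiniteNevanlinna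

/-! ### Existence: convergence of the iteration, parameter `1` -/

lemma isCompact_probabilityMeasure_real_compl_closedBall_le {B : ℝ} (hB : 0 ≤ B) :
    IsCompact {F : ProbabilityMeasure ℝ | ∀ n : ℕ,
      (F : Measure ℝ).real (Metric.closedBall 0 ((n : ℝ) + 1))ᶜ ≤ B / ((n : ℝ) + 1) ^ 2} := by
  have hlim : Tendsto (fun n : ℕ => B / ((n : ℝ) + 1) ^ 2) atTop (𝓝 0) :=
    tendsto_const_nhds.div_atTop ((tendsto_pow_atTop two_ne_zero).comp
      (tendsto_atTop_add_const_right _ _ tendsto_natCast_atTop_atTop))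
  have hlim' : Tendsto (fun n : ℕ => (B / ((n : ℝ) + 1) ^ 2).toNNReal) atTop (𝓝 0) := by
    have := (continuous_real_toNNReal.tendsto 0).comp hlim
    rwa [Real.toNNReal_zero] at this
  have hc := isCompact_setOfPred_probabilityMeasure_mass_eq_compl_isCompact_le (E := ℝ)
    (K := fun n : ℕ => Metric.closedBall (0 : ℝ) ((n : ℝ) + 1)) hlim'
    (fun n => isCompact_closedBall _ _) (Or.inl inferInstance)
  convert hc using 3 with F
  refine forall_congr' fun n => ?_
  rw [← NNReal.coe_le_coe, Real.coe_toNNReal _ (by positivity)]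
  rfl

lemma tendsto_cauchyTransform {u : ℕ → ProbabilityMeasure ℝ} {F : ProbabilityMeasure ℝ}
    (h : Tendsto u atTop (𝓝 F)) {z : ℂ} (hz : 0 < z.im) :
    Tendsto (fun n => cauchyTransform (u n) z) atTop (𝓝 (cauchyTransform F z)) := by
  rw [ProbabilityMeasure.tendsto_iff_forall_integral_rclike_tendsto ℂ] at h
  exact h (BoundedContinuousFunction.ofNormedAddCommGroup _ (continuous_one_div_sub_ofReal hz) _
    (norm_one_div_sub_ofReal_le hz))

namespace TwoPoleMap

variable (P : TwoPoleMap)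

/-- The iterates that approximate the right inverse of the map on the upper half-plane. -/
noncomputable def iterate : ℕ → ℂ → ℂ
  -- The whole mass at a pole at `0`, so that the start has the same `a` and `K` as all later
  -- iterates.
  | 0 => fun z => z - P.C - ((P.k₁ + P.k₂ : ℝ) : ℂ) / z
  | n + 1 => fun z => z - P.C - (P.k₁ / (iterate n z - P.x₁) + P.k₂ / (iterate n z - P.x₂))

lemma iterate_succ (n : ℕ) (z : ℂ) : P.iterate (n + 1) z =
    z - P.C - (P.k₁ / (P.iterate n z - P.x₁) + P.k₂ / (P.iterate n z - P.x₂)) := rfl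

lemma isFiniteNevanlinna_iterate (n : ℕ) :
    IsFiniteNevanlinna P.C (P.k₁ + P.k₂) (P.iterate n) := by
  have h₁ := P.k₁_pos.le
  have h₂ := P.k₂_pos.le
  induction n with
  | zero =>
    exact ⟨Unit, inferInstance, fun _ => P.k₁ + P.k₂, fun _ => 0, fun _ => add_nonneg h₁ h₂,
      by simp, fun z _ => by simp [iterate]⟩
  | succ n ih => exact ih.step P.C P.x₁ P.x₂ h₁ h₂

lemma norm_div_sub_div_le {k Y : ℝ} (hk : 0 ≤ k) (hY : 0 < Y) (x : ℝ) {u v : ℂ} (hu : Y ≤ u.im)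
    (hv : Y ≤ v.im) : ‖(k : ℂ) / (u - x) - k / (v - x)‖ ≤ k / Y ^ 2 * ‖u - v‖ := by
  have hu0 := sub_ofReal_ne_zero (hY.trans_le hu) x
  have hv0 := sub_ofReal_ne_zero (hY.trans_le hv) x
  have e : (k : ℂ) / (u - x) - k / (v - x) = k * (v - u) / ((u - x) * (v - x)) := by
    field_simp
    ring
  rw [e, norm_div, norm_mul, norm_mul, Complex.norm_real, Real.norm_of_nonneg hk, norm_sub_rev,
    div_mul_eq_mul_div, sq]
  have h1 := hu.trans (im_le_norm_sub_ofReal u x)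
  have h2 := hv.trans (im_le_norm_sub_ofReal v x)
  gcongr

/-- Iterates keep imaginary part at least `Im z`, where the iteration has Lipschitz constant `(k₁ +
k₂) / (Im z)² ≤ 1 / 2`. -/
lemma exists_tendsto_iterate {z : ℂ} (hz : 0 < z.im) (hz' : 2 * (P.k₁ + P.k₂) ≤ z.im ^ 2) :
    ∃ w : ℂ, 0 < w.im ∧ P.map w = z ∧ Tendsto (fun n => P.iterate n z) atTop (𝓝 w) := by
  have him : ∀ n, z.im ≤ (P.iterate n z).im := fun n => (P.isFiniteNevanlinna_iterate n).im_le hz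
  have hstep : ∀ n, ‖P.iterate (n + 1) z - P.iterate (n + 2) z‖ ≤
      1 / 2 * ‖P.iterate n z - P.iterate (n + 1) z‖ := by
    intro n
    have e : P.iterate (n + 1) z - P.iterate (n + 2) z =
        -((P.k₁ / (P.iterate n z - P.x₁) - P.k₁ / (P.iterate (n + 1) z - P.x₁))
          + (P.k₂ / (P.iterate n z - P.x₂) - P.k₂ / (P.iterate (n + 1) z - P.x₂))) := by
      linear_combination P.iterate_succ n z - P.iterate_succ (n + 1) z
    rw [e, norm_neg]
    refine (norm_add_le _ _).trans ((add_le_add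
      (norm_div_sub_div_le P.k₁_pos.le hz P.x₁ (him n) (him (n + 1)))
      (norm_div_sub_div_le P.k₂_pos.le hz P.x₂ (him n) (him (n + 1)))).trans ?_)
    rw [← add_mul, ← add_div]
    refine mul_le_mul_of_nonneg_right ?_ (norm_nonneg _)
    rw [div_le_div_iff₀ (by positivity) two_pos]
    linarith
  have hgeom : ∀ n, dist (P.iterate n z) (P.iterate (n + 1) z) ≤
      ‖P.iterate 0 z - P.iterate 1 z‖ * (1 / 2) ^ n := by
    intro n
    rw [dist_eq_norm]
    induction n with
    | zero => simp
    | succ n ih =>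
      refine (hstep n).trans ?_
      rw [pow_succ]
      linarith
  obtain ⟨w, hw⟩ := cauchySeq_tendsto_of_complete
    (cauchySeq_of_le_geometric (1 / 2) _ (by norm_num) hgeom)
  have hwim : z.im ≤ w.im :=
    ge_of_tendsto' ((Complex.continuous_im.tendsto w).comp hw) him
  have hw0 : 0 < w.im := hz.trans_le hwim
  refine ⟨w, hw0, ?_, hw⟩
  have h1 := (tendsto_add_atTop_iff_nat 1).2 hw
  have h2 : Tendsto (fun n => P.iterate (n + 1) z) atTop
      (𝓝 (z - P.C - (P.k₁ / (w - P.x₁) + P.k₂ / (w - P.x₂)))) := by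
    simp only [iterate_succ]
    exact tendsto_const_nhds.sub
      ((tendsto_const_nhds.div (hw.sub_const _) (sub_ofReal_ne_zero hw0 _)).add
        (tendsto_const_nhds.div (hw.sub_const _) (sub_ofReal_ne_zero hw0 _)))
  have h3 := tendsto_nhds_unique h1 h2
  rw [map]
  linear_combination h3

lemma differentiableAt_map {w : ℂ} (h₁ : w ≠ P.x₁) (h₂ : w ≠ P.x₂) :
    DifferentiableAt ℂ P.map w := by
  have := sub_ne_zero.2 h₁
  have := sub_ne_zero.2 h₂
  unfold map
  fun_prop (disch := assumption)

/-- The right inverse of the map on the upper half-plane is the reciprocal of a Cauchy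
transform. -/
lemma exists_isSubordinated_one : ∃ F : Measure ℝ, IsSubordinated 1 P F := by
  have hKpos : 0 < P.k₁ + P.k₂ := add_pos P.k₁_pos P.k₂_pos
  choose u hu hutail using fun n => (P.isFiniteNevanlinna_iterate n).exists_probabilityMeasure
  obtain ⟨F, -, φ, hφ, hF⟩ :=
    (isCompact_probabilityMeasure_real_compl_closedBall_le
      (B := P.C ^ 2 + (P.k₁ + P.k₂)) (add_nonneg (sq_nonneg _) hKpos.le)).tendsto_subseq
      (x := u) fun n m => hutail n _ (by positivity)
  have hlarge : ∀ z : ℂ, 0 < z.im → 2 * (P.k₁ + P.k₂) ≤ z.im ^ 2 →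
      P.map (cauchyTransform F z)⁻¹ = z := by
    intro z hz hz'
    obtain ⟨w, hw, hwz, hlim⟩ := P.exists_tendsto_iterate hz hz'
    have hw0 : w ≠ 0 := by rintro rfl; simp at hw
    have h1 := tendsto_cauchyTransform hF hz
    have h2 : Tendsto (fun n => cauchyTransform ((u ∘ φ) n) z) atTop (𝓝 w⁻¹) := by
      refine ((hlim.comp hφ.tendsto_atTop).inv₀ hw0).congr fun n => ?_
      rw [Function.comp_apply, Function.comp_apply, hu _ z hz, one_div]
    rw [tendsto_nhds_unique h1 h2, inv_inv, hwz]
  have hG0 : ∀ z : ℂ, 0 < z.im → cauchyTransform F z ≠ 0 := fun z hz h0 => by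
    have := im_cauchyTransform_neg F hz
    rw [h0] at this; simp at this
  have hinv : ∀ z : ℂ, 0 < z.im → 0 < ((cauchyTransform F z)⁻¹).im := fun z hz => by
    rw [Complex.inv_im]
    exact div_pos (by linarith [im_cauchyTransform_neg F hz]) (Complex.normSq_pos.2 (hG0 z hz))
  have hopen : IsOpen {z : ℂ | 0 < z.im} := isOpen_lt continuous_const Complex.continuous_im
  -- The equation is known only for large `Im z`; the identity theorem extends it to the whole
  -- half-plane.
  have hana : AnalyticOnNhd ℂ (fun z => P.map (cauchyTransform F z)⁻¹ - z) {z : ℂ | 0 < z.im} := by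
    refine DifferentiableOn.analyticOnNhd (fun z hz => ?_) hopen
    refine (DifferentiableAt.sub ?_ differentiableAt_id).differentiableWithinAt
    exact (P.differentiableAt_map (ne_ofReal_of_im_pos (hinv z hz) _)
      (ne_ofReal_of_im_pos (hinv z hz) _)).comp z
      ((differentiableAt_cauchyTransform_of_im_pos F hz).inv (hG0 z hz))
  set K := P.k₁ + P.k₂ with hK
  have hz₀ : (0 : ℝ) < (((2 * K + 2 : ℝ) : ℂ) * Complex.I).im := by
    rw [Complex.im_ofReal_mul, Complex.I_im]; positivity
  have hev : (fun z => P.map (cauchyTransform F z)⁻¹ - z)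
      =ᶠ[𝓝 (((2 * K + 2 : ℝ) : ℂ) * Complex.I)] 0 := by
    have : ∀ᶠ z : ℂ in 𝓝 (((2 * K + 2 : ℝ) : ℂ) * Complex.I), 2 * K + 1 < z.im := by
      refine (isOpen_lt continuous_const Complex.continuous_im).mem_nhds ?_
      change 2 * K + 1 < (((2 * K + 2 : ℝ) : ℂ) * Complex.I).im
      rw [Complex.im_ofReal_mul, Complex.I_im]; linarith
    filter_upwards [this] with z hz
    rw [hlarge z (by linarith) (by nlinarith), sub_self, Pi.zero_apply]
  have hzero := hana.eqOn_zero_of_preconnected_of_eventuallyEq_zero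
    (convex_halfSpace_im_gt 0).isPreconnected hz₀ hev
  refine ⟨F, inferInstance, fun z hz => ⟨(cauchyTransform F z)⁻¹, hinv z hz,
    sub_eq_zero.1 (hzero hz), ?_⟩⟩
  rw [inv_inv]
  simp

end TwoPoleMap

/-! ### Existence for every ratio `c` -/

/-- An atom of mass `1 - 1/c` at `0` contributes `(c - 1) / z` to `c G`, cancelling the term `(1 -
c) / z`. -/
lemma IsSubordinated.of_one_le {c : ℝ} {P : TwoPoleMap} {F : Measure ℝ} (hc : 1 ≤ c)
    (h : IsSubordinated 1 P F) :
    IsSubordinated c P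
      (ENNReal.ofReal (1 / c) • F + ENNReal.ofReal (1 - 1 / c) • Measure.dirac 0) := by
  obtain ⟨hF, hw⟩ := h
  have hc0 : 0 < c := by linarith
  have h1 : 0 ≤ 1 / c := by positivity
  have h2 : 0 ≤ 1 - 1 / c := by
    rw [sub_nonneg, div_le_one hc0]; exact hc
  refine ⟨⟨?_⟩, fun z hz => ?_⟩
  · simp only [Measure.add_apply, Measure.smul_apply, smul_eq_mul, measure_univ, mul_one]
    rw [← ENNReal.ofReal_add h1 h2]
    simp
  · obtain ⟨w, hwim, hwz, hG⟩ := hw z hz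
    refine ⟨w, hwim, hwz, ?_⟩
    have hz0 : z ≠ 0 := by rintro rfl; simp at hz
    have hcC : (c : ℂ) ≠ 0 := by exact_mod_cast hc0.ne'
    rw [hG]
    simp only [cauchyTransform]
    rw [integral_add_measure, integral_smul_measure, integral_smul_measure, integral_dirac,
      ENNReal.toReal_ofReal h1, ENNReal.toReal_ofReal h2, Complex.real_smul, Complex.real_smul]
    · push_cast
      rw [sub_zero]
      field_simp
      ring
    · exact (integrable_one_div_sub_ofReal _ hz).smul_measure ENNReal.ofReal_ne_top
    · exact (integrable_one_div_sub_ofReal _ hz).smul_measure ENNReal.ofReal_ne_top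

lemma IsSubordinated.of_atom {c : ℝ} {P : TwoPoleMap} {F : Measure ℝ} (hc : 0 < c)
    (h : IsSubordinated 1 P F) (h0 : F.real {0} = 1 - c) :
    IsSubordinated c P (ENNReal.ofReal (1 / c) • F.restrict {0}ᶜ) := by
  obtain ⟨hF, hw⟩ := h
  have h1 : 0 ≤ 1 / c := by positivity
  have hcompl : F.real {0}ᶜ = c := by
    rw [probReal_compl_eq_one_sub (measurableSet_singleton 0), h0]; ring
  refine ⟨⟨?_⟩, fun z hz => ?_⟩
  · rw [Measure.smul_apply, Measure.restrict_apply MeasurableSet.univ, univ_inter, smul_eq_mul,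
      ← ofReal_measureReal, hcompl, ← ENNReal.ofReal_mul h1, one_div_mul_cancel hc.ne',
      ENNReal.ofReal_one]
  · obtain ⟨w, hwim, hwz, hG⟩ := hw z hz
    refine ⟨w, hwim, hwz, ?_⟩
    have hz0 : z ≠ 0 := by rintro rfl; simp at hz
    have hcC : (c : ℂ) ≠ 0 := by exact_mod_cast hc.ne'
    have hsplit := integral_add_compl (measurableSet_singleton (0 : ℝ))
      (integrable_one_div_sub_ofReal F hz)
    rw [integral_singleton, h0, Complex.real_smul] at hsplit
    rw [hG]
    simp only [cauchyTransform]
    rw [integral_smul_measure, ENNReal.toReal_ofReal h1, Complex.real_smul, ← hsplit]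
    push_cast
    rw [sub_zero]
    field_simp
    ring

/-- For `c < 1`, the parameter-`1` law of the same map has an atom of mass `P'(0) = 1 - c` at `0`;
deleting it and rescaling gives the law. -/
lemma exists_isMPLaw {c r s t : ℝ} (hc : 0 < c) (hr0 : 0 < r) (hr1 : r < 1) (hs : 0 < s)
    (ht : 0 < t) : ∃ F : Measure ℝ, IsMPLaw c (populationLaw r s t) F := by
  simp only [isMPLaw_iff hc hr0 hr1 hs ht]
  obtain ⟨F, hF⟩ := (marchenkoPasturMap hc hr0 hr1 hs ht).exists_isSubordinated_one
  rcases le_or_gt 1 c with h | h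
  · exact ⟨_, hF.of_one_le h⟩
  · have hslope := marchenkoPasturMap_realSlope_zero hc hr0 hr1 hs ht
    have hatom := hF.atom_of_map_zero ht.ne' (by simp only [marchenkoPasturMap]; positivity)
      (by rwa [hslope]) (marchenkoPasturMap_realMap_zero hc hr0 hr1 hs ht)
    rw [hslope, one_mul] at hatom
    exact ⟨_, hF.of_atom hc hatom⟩

lemma isMPLaw_limitLaw {c r s t : ℝ} (hc : 0 < c) (hr0 : 0 < r) (hr1 : r < 1) (hs : 0 < s)
    (ht : 0 < t) : IsMPLaw c (populationLaw r s t) (limitLaw c r s t) := by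
  have h := exists_isMPLaw hc hr0 hr1 hs ht
  rw [limitLaw, mpLaw, dif_pos h]
  exact h.choose_spec

end NoisyPCA

theorem proposition1 (c r s : ℝ) (hc : 0 < c) (hr0 : 0 < r) (hr1 : r < 1) (hs : 0 < s) :
    ∃ T : ℝ, 0 ≤ T ∧ ∀ t : ℝ, T ≤ t →
      (c ≤ 1 → NoisyPCA.numComponents c r s t = 1 ∧ NoisyPCA.utility c r s t = 0) ∧
      (1 < c →
        (NoisyPCA.limitLaw c r s t).real {0} = 1 - 1 / c ∧
        NoisyPCA.componentCount (NoisyPCA.nonzeroSupport c r s t) = 1 ∧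
        NoisyPCA.componentGap (NoisyPCA.nonzeroSupport c r s t) = 0) := by
  have hcr : 0 < c * (1 - r) := mul_pos hc (by linarith)
  have hdiv : 0 ≤ s ^ 2 / (c * (1 - r)) := by positivity
  -- The summand `1` gives `t ≥ 1`, so `t ≤ t²` and `s² < c (1 - r) t² = k₁`, the condition that
  -- excludes a gap.
  refine ⟨s ^ 2 / (c * (1 - r)) + 1, by linarith, fun t hT => ?_⟩
  have ht1 : 1 ≤ t := by linarith
  have ht : 0 < t := by linarith
  have hgap : s ^ 2 < c * (1 - r) * t ^ 2 := by
    have h1 : s ^ 2 / (c * (1 - r)) < t := by linarith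
    rw [div_lt_iff₀ hcr] at h1
    nlinarith
  set P := NoisyPCA.marchenkoPasturMap hc hr0 hr1 hs ht with hP
  set F := NoisyPCA.limitLaw c r s t with hFdef
  have hsub : NoisyPCA.IsSubordinated c P F :=
    (NoisyPCA.isMPLaw_iff hc hr0 hr1 hs ht F).1 (NoisyPCA.isMPLaw_limitLaw hc hr0 hr1 hs ht)
  have hF : IsProbabilityMeasure F := hsub.1
  have hx₁ : P.x₁ ≠ 0 := ht.ne'
  have hx₂ : P.x₂ ≠ 0 := (add_pos hs ht).ne'
  have hmap : P.realMap 0 = 0 := NoisyPCA.marchenkoPasturMap_realMap_zero hc hr0 hr1 hs ht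
  have hslope : P.realSlope 0 = c := NoisyPCA.marchenkoPasturMap_realSlope_zero hc hr0 hr1 hs ht
  obtain ⟨a, b, hab, hne, hIcc, hins, hzero, hroot⟩ := hsub.exists_support_eq hc
    (show t < s + t by linarith) ht (show (s + t - t) ^ 2 < c * (1 - r) * t ^ 2 by
      rwa [add_sub_cancel_right]) hmap
  rw [hslope] at hzero hroot
  refine ⟨fun hc1 => ?_, fun hc1 => ?_⟩
  · have hsupp : F.support = Set.Icc a b := by
      -- For `c = 1` the interval itself starts at `0`; for `c < 1` the atom at `0` has mass zero,
      -- so removing `0` changes nothing.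
      rcases hc1.eq_or_lt with h1 | h1
      · have ha := hzero h1
        refine Set.Subset.antisymm (fun x hx => ?_) hIcc
        rcases hins hx with rfl | hx
        · exact ⟨ha.le, by linarith⟩
        · exact hx
      · have hatom := hsub.atom_of_map_zero hx₁ hx₂ (by rwa [hslope]) hmap
        rw [hslope, sub_self, mul_eq_zero, measureReal_eq_zero_iff] at hatom
        rw [← hne, MeasureTheory.Measure.restrict_eq_self_of_ae_mem]
        rw [MeasureTheory.ae_iff]
        simpa using hatom.resolve_left hc.ne'
    rw [NoisyPCA.numComponents, NoisyPCA.utility, ← hFdef, hsupp]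
    exact ⟨NoisyPCA.componentCount_Icc hab.le, NoisyPCA.componentGap_Icc hab.le⟩
  · refine ⟨?_, ?_⟩
    -- Since `realSlope 0 = c > 1`, the zero `v = 0` of `P` is unusable; the negative zero gives the
    -- atom.
    · obtain ⟨v, hv, hvs, hv0⟩ := hroot hc1
      have hatom := hsub.atom_of_ne_zero (show v ≠ t by linarith) (show v ≠ s + t by linarith)
        hvs hv0 hv.ne
      rw [eq_sub_iff_add_eq]
      field_simp
      linarith
    · rw [NoisyPCA.nonzeroSupport, ← hFdef, hne]
      exact ⟨NoisyPCA.componentCount_Icc hab.le, NoisyPCA.componentGap_Icc hab.le⟩
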